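/- Let $n>k\ge 2$ be integers. **Trees.** A rooted tree on $n$ labelled leaves is a finite tree whose vertices of degree $1$ (the leaves) are labelled bijectively by $1,\dots,n$, with a distinguished root of degree at least $2$, all other non-leaves (the internal vertices) having degree at least $3$. Its combinatorial type is its class under label- and root-preserving isomorphisms. An internal edge is an edge not adjacent to a leaf; the outdegree of a vertex is the number of its children; a preleaf is a non-leaf all of whose children are leaves. The complex of $k$-equal trees $T_{n,k}$ is the abstract simplicial complex with maximal simplices the combinatorial types of rooted trees on $n$ labelled leaves in which every preleaf has outdegree $k$ and every other non-leaf has outdegree $2$, and lower dimensional simplices obtained from these by contracting internal edges. That is, the vertices of $T_{n,k}$ are the types with exactly one internal edge obtained from such trees by contraction, and the simplex given by a type $T$ has as its vertices the types with exactly one internal edge obtained from $T$ by contraction. **Lattice.** Let $\Pi_{n,k}$ be the lattice consisting of all joins (including the empty join), in the lattice of set partitions of $\{1,\dots,n\}$ with finer partitions smaller, of partitions with a single non-singleton block, of size $k$. An element $X>\hat 0$ of a finite lattice is irreducible if $[\hat 0,X]$ is not isomorphic to a product of two posets with more than one element each; $\mathcal I$ is the set of irreducible elements of $\Pi_{n,k}$.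 The reduced minimal nested set complex $\mathcal N(\Pi_{n,k},\mathcal I)$ has as simplices the non-empty sets $S\subseteq \mathcal I\setminus\{\hat 1\}$ such that the join of any at least two pairwise incomparable elements of $S$ does not belong to $\mathcal I$. The order complex $\Delta(\Pi_{n,k})$ has as simplices the non-empty chains in $\Pi_{n,k}\setminus\{\hat 0,\hat 1\}$. **Proposition.** 1. $T_{n,k}$ is well defined as an abstract simplicial complex: its simplices correspond bijectively, via the vertex sets described above, to the types with at least one internal edge that are obtained from the above maximal types by contracting internal edges; for these types together with the one without internal edges (which has empty vertex set), inclusion of vertex sets corresponds to contraction of internal edges. The maximal simplices are exactly those given by the above maximal types. 2. $T_{n,k}$ and $\mathcal N(\Pi_{n,k},\mathcal I)$ coincide as abstract simplicial complexes: there is an isomorphism between them which maps the simplex given by a tree $T$ to the nested set consisting, for all internal vertices $t$ of $T$, of the partitions whose only non-singleton block is the set of labels of leaves below $t$. 3. In particular, $\Delta(\Pi_{n,k})$ is obtained (up to isomorphism of abstract simplicial complexes) from $T_{n,k}$ by a finite sequence of stellar subdivisions. -/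

import Mathlib

namespace TreeComplex

/-! ## Abstract simplicial complexes -/

/-- The vertices of an abstract simplicial complex. -/
def vertices {V : Type*} (K : PreAbstractSimplicialComplex V) : Set V :=
  {v | {v} ∈ K.faces}

/-- An isomorphism of abstract simplicial complexes: a bijection of the vertex sets under which
the faces correspond to the faces. -/
structure ComplexIso {V W : Type*} (K : PreAbstractSimplicialComplex V)
    (L : PreAbstractSimplicialComplex W) where
  toEquiv : vertices K ≃ vertices L
  mem_faces_iff : ∀ s : Finset (vertices K),
    s.map (Function.Embedding.subtype _) ∈ K.faces ↔
      (s.map toEquiv.toEmbedding).map (Function.Embedding.subtype _) ∈ L.faces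

open Classical in
/-- The stellar subdivision of `K` in the simplex `σ`, with new vertex `v`: the simplices that
contain `σ` are removed, and for every (possibly empty) `ρ` which does not contain `σ` and for
which `ρ ∪ σ` is a simplex, the simplex `ρ ∪ {v}` is added. -/
def stellarSubdivision {V : Type*} (K : PreAbstractSimplicialComplex V) (σ : Finset V) (v : V) :
    PreAbstractSimplicialComplex V where
  faces := {τ | τ ∈ K.faces ∧ ¬ σ ⊆ τ} ∪
    {τ | ∃ ρ : Finset V, ρ ∪ σ ∈ K.faces ∧ ¬ σ ⊆ ρ ∧ τ = insert v ρ}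
  isRelLowerSet_faces := by
    rintro τ (⟨hτ, hστ⟩ | ⟨ρ, hρ, hσρ, rfl⟩)
    · exact ⟨(K.isRelLowerSet_faces hτ).1, fun t ht hne =>
        Or.inl ⟨(K.isRelLowerSet_faces hτ).2 ht hne, fun h => hστ (h.trans ht)⟩⟩
    · refine ⟨Finset.insert_nonempty _ _, fun t ht hne => ?_⟩
      have hσ : σ.Nonempty := by
        rcases σ.eq_empty_or_nonempty with h | h
        · exact absurd (h ▸ Finset.empty_subset ρ) hσρ
        · exact h
      by_cases hv : v ∈ t
      · have hsub : t.erase v ⊆ ρ := by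
          intro x hx
          rcases Finset.mem_insert.1 (ht (Finset.mem_of_mem_erase hx)) with h | h
          · exact absurd h (Finset.ne_of_mem_erase hx)
          · exact h
        refine Or.inr ⟨t.erase v, ?_, fun h => hσρ (h.trans hsub),
          (Finset.insert_erase hv).symm⟩
        exact (K.isRelLowerSet_faces hρ).2 (Finset.union_subset_union_left hsub)
          (hσ.mono Finset.subset_union_right)
      · have hsub : t ⊆ ρ := (Finset.subset_insert_iff_of_notMem hv).1 ht
        exact Or.inl ⟨(K.isRelLowerSet_faces hρ).2 (hsub.trans Finset.subset_union_left) hne,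
          fun h => hσρ (h.trans hsub)⟩

/-- `K'` is a stellar subdivision of `K` in one of its simplices, with a new vertex. -/
def IsStellarSubdivision {V : Type*} (K K' : PreAbstractSimplicialComplex V) : Prop :=
  ∃ σ ∈ K.faces, ∃ v, v ∉ vertices K ∧ K' = stellarSubdivision K σ v

/-- Up to isomorphism of abstract simplicial complexes, `L` is obtained from `K` by a finite
sequence of stellar subdivisions. -/
def ObtainedByStellarSubdivisions {V W : Type*} (K : PreAbstractSimplicialComplex V)
    (L : PreAbstractSimplicialComplex W) : Prop :=
  ∃ (U : Type) (K₀ L₀ : PreAbstractSimplicialComplex U), Nonempty (ComplexIso K K₀) ∧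
    Relation.ReflTransGen IsStellarSubdivision K₀ L₀ ∧ Nonempty (ComplexIso L₀ L)

/-! ## Nested sets in lattices -/

section Lattice

variable {L : Type*} [Lattice L] [BoundedOrder L]

/-- `S` is nested with respect to `G`: it is a subset of `G`, and the join of any at least two
pairwise incomparable elements of `S` does not belong to `G`. -/
def IsNested (G : Set L) (S : Finset L) : Prop :=
  (S : Set L) ⊆ G ∧ ∀ A : Finset L, A ⊆ S → 2 ≤ A.card → IsAntichain (· ≤ ·) (A : Set L) →
    A.sup id ∉ G

/-- The reduced nested set complex `𝒩(L, G)`: its simplices are the nonempty `G`-nested sets that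
do not contain the maximal element. -/
def reducedNestedSetComplex (G : Set L) : PreAbstractSimplicialComplex L where
  faces := {S | S.Nonempty ∧ IsNested G S ∧ ⊤ ∉ S}
  isRelLowerSet_faces := by
    rintro S ⟨hne, ⟨hG, hj⟩, htop⟩
    exact ⟨hne, fun T hT hTne => ⟨hTne, ⟨(Finset.coe_subset.2 hT).trans hG,
      fun A hA => hj A (hA.trans hT)⟩, fun h => htop (hT h)⟩⟩

/-- The order complex of the proper part `L \ {⊥, ⊤}` of a bounded lattice. -/
def orderComplex (L : Type*) [Lattice L] [BoundedOrder L] : PreAbstractSimplicialComplex L where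
  faces := {S | S.Nonempty ∧ ⊥ ∉ S ∧ ⊤ ∉ S ∧ IsChain (· ≤ ·) (S : Set L)}
  isRelLowerSet_faces := by
    rintro S ⟨hne, hbot, htop, hc⟩
    exact ⟨hne, fun T hT hTne => ⟨hTne, fun h => hbot (hT h), fun h => htop (hT h),
      hc.mono (Finset.coe_subset.2 hT)⟩⟩

end Lattice

/-- The irreducible elements of a bounded lattice: the elements `X > ⊥` for which the interval
`[⊥, X]` is not isomorphic to a product of two posets with more than one element each. -/
def irreducibles.{u} (L : Type u) [Lattice L] [BoundedOrder L] : Set L :=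
  {X | ⊥ < X ∧ ∀ (P Q : Type u) [PartialOrder P] [PartialOrder Q],
    Nonempty (Set.Icc ⊥ X ≃o P × Q) → Subsingleton P ∨ Subsingleton Q}

/-! ## The `k`-equal lattice -/

/-- The set partition of `{1, …, n}` (as an equivalence relation) in which `B` is a block and all
elements outside `B` are singleton blocks. -/
def blockPartition {n : ℕ} (B : Set (Fin n)) : Setoid (Fin n) where
  r i j := i = j ∨ (i ∈ B ∧ j ∈ B)
  iseqv :=
    { refl := fun _ => Or.inl rfl
      symm := by
        rintro x y (rfl | ⟨h, h'⟩)
        · exact Or.inl rfl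
        · exact Or.inr ⟨h', h⟩
      trans := by
        rintro x y z (rfl | ⟨h, h'⟩) (rfl | ⟨g, g'⟩)
        · exact Or.inl rfl
        · exact Or.inr ⟨g, g'⟩
        · exact Or.inr ⟨h, h'⟩
        · exact Or.inr ⟨h, g'⟩ }

/-- The partitions of `{1, …, n}` with a single nontrivial block, which has size `k`. -/
def kBlockPartitions (n k : ℕ) : Set (Setoid (Fin n)) :=
  {π | ∃ B : Set (Fin n), B.ncard = k ∧ π = blockPartition B}

/-- The `k`-equal lattice `Π_{n,k}`: the joins, in the lattice of all set partitions of
`{1, …, n}`, of sets of partitions with a single nontrivial block of size `k` (the empty join is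
the partition into singletons). The order is the one of `Setoid`: finer partitions are smaller. -/
def KEqualLattice (n k : ℕ) : Type :=
  {π : Setoid (Fin n) // ∃ A ⊆ kBlockPartitions n k, π = sSup A}

namespace KEqualLattice

variable {n k : ℕ}

instance : PartialOrder (KEqualLattice n k) :=
  inferInstanceAs (PartialOrder {π : Setoid (Fin n) // ∃ A ⊆ kBlockPartitions n k, π = sSup A})

/-- Joins in `Π_{n,k}` are joins of partitions. -/
instance : SupSet (KEqualLattice n k) where
  sSup S := ⟨sSup (Subtype.val '' S),
    {a | a ∈ kBlockPartitions n k ∧ ∃ π ∈ S, a ≤ π.1}, fun _ h => h.1, by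
      apply le_antisymm
      · apply sSup_le
        rintro _ ⟨π, hπ, rfl⟩
        obtain ⟨A, hA, h⟩ := π.2
        rw [h]
        refine sSup_le_sSup fun a ha => ⟨hA ha, π, hπ, ?_⟩
        rw [h]
        exact le_sSup ha
      · apply sSup_le
        rintro a ⟨_, π, hπ, h⟩
        exact h.trans (le_sSup ⟨π, hπ, rfl⟩)⟩

theorem isLUB_sSup (S : Set (KEqualLattice n k)) : IsLUB S (sSup S) := by
  constructor
  · intro π hπ
    exact le_sSup (α := Setoid (Fin n)) ⟨π, hπ, rfl⟩
  · intro b hb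
    apply sSup_le (α := Setoid (Fin n))
    rintro _ ⟨π, hπ, rfl⟩
    exact hb hπ

instance : CompleteLattice (KEqualLattice n k) := completeLatticeOfSup _ isLUB_sSup

end KEqualLattice

/-! ## Trees -/

/-- A finite rooted tree with `n` leaves labelled `1, …, n`. Leaves are the vertices of degree `1`;
the root has degree at least `2`, and all other non-leaves have degree at least `3`. -/
structure LabelledTree (n : ℕ) where
  V : Type
  finite : Finite V
  graph : SimpleGraph V
  isTree : graph.IsTree
  root : V
  leaf : Fin n → V
  leaf_injective : Function.Injective leaf
  range_leaf : Set.range leaf = {v | (graph.neighborSet v).ncard = 1}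
  two_le_degree_root : 2 ≤ (graph.neighborSet root).ncard
  three_le_degree : ∀ v, v ∉ Set.range leaf → v ≠ root → 3 ≤ (graph.neighborSet v).ncard

namespace LabelledTree

variable {n : ℕ}

/-- `v` is a leaf. -/
def IsLeaf (T : LabelledTree n) (v : T.V) : Prop := v ∈ Set.range T.leaf

/-- The internal vertices: neither a leaf nor the root. -/
def IsInternal (T : LabelledTree n) (v : T.V) : Prop := ¬ T.IsLeaf v ∧ v ≠ T.root

/-- `t` lies on the path from `v` to the root, that is, `v` is below `t` (or equal to it). -/
def Below (T : LabelledTree n) (v t : T.V) : Prop :=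
  ∀ p : T.graph.Walk v T.root, p.IsPath → t ∈ p.support

/-- The children of `v`: the neighbours of `v` not on the path from `v` to the root. -/
def children (T : LabelledTree n) (v : T.V) : Set T.V :=
  {w | T.graph.Adj v w ∧ ¬ T.Below v w}

/-- The outdegree of a vertex. -/
noncomputable def outdegree (T : LabelledTree n) (v : T.V) : ℕ := (T.children v).ncard

/-- The internal edges: the edges that are not adjacent to a leaf. -/
def internalEdges (T : LabelledTree n) : Set (Sym2 T.V) :=
  {e | e ∈ T.graph.edgeSet ∧ ∀ v ∈ e, ¬ T.IsLeaf v}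

/-- The preleaves: the non-leaves all of whose children are leaves, that is, the leaves of the
rooted tree obtained by removing the leaves. -/
def IsPreleaf (T : LabelledTree n) (v : T.V) : Prop :=
  ¬ T.IsLeaf v ∧ ∀ w ∈ T.children v, T.IsLeaf w

/-- The tree is binary except at preleaves, where it is `k`-ary. -/
def IsKEqualBinary (k : ℕ) (T : LabelledTree n) : Prop :=
  ∀ v, ¬ T.IsLeaf v →
    (T.IsPreleaf v → T.outdegree v = k) ∧ (¬ T.IsPreleaf v → T.outdegree v = 2)

/-- The set of labels of the leaves below `t`. -/
def leavesBelow (T : LabelledTree n) (t : T.V) : Set (Fin n) := {i | T.Below (T.leaf i) t}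

/-- The set of partitions associated with a tree: for every internal vertex `t`, the partition
whose only nontrivial block is the set of leaves below `t`. -/
def nestedSet (T : LabelledTree n) : Set (Setoid (Fin n)) :=
  {π | ∃ t, T.IsInternal t ∧ π = blockPartition (T.leavesBelow t)}

/-- `T'` is obtained from `T` by contracting a set `E` of internal edges: `f` identifies exactly
the vertices that are joined by edges in `E`. -/
def IsContraction (T T' : LabelledTree n) : Prop :=
  ∃ E ⊆ T.internalEdges, ∃ f : T.V → T'.V, Function.Surjective f ∧
    (∀ u v, f u = f v ↔ (SimpleGraph.fromEdgeSet E).Reachable u v) ∧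
    (∀ a b, T'.graph.Adj a b ↔ a ≠ b ∧ ∃ u v, f u = a ∧ f v = b ∧ T.graph.Adj u v) ∧
    f T.root = T'.root ∧ ∀ i, f (T.leaf i) = T'.leaf i

/-- Two labelled rooted trees have the same combinatorial type if there is a label- and
root-preserving isomorphism of graphs. (As only the root may have degree `2`, every label- and
root-preserving homeomorphism maps vertices to vertices and edges to edges.) -/
instance setoid (n : ℕ) : Setoid (LabelledTree n) where
  r T T' := ∃ f : T.graph ≃g T'.graph, f T.root = T'.root ∧ ∀ i, f (T.leaf i) = T'.leaf i
  iseqv :=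
    { refl := fun _ => ⟨SimpleGraph.Iso.refl, rfl, fun _ => rfl⟩
      symm := by
        rintro T T' ⟨f, hr, hl⟩
        exact ⟨f.symm, by rw [← hr]; exact f.symm_apply_apply _,
          fun i => by rw [← hl]; exact f.symm_apply_apply _⟩
      trans := by
        rintro T T' T'' ⟨f, hr, hl⟩ ⟨g, gr, gl⟩
        exact ⟨f.trans g, (congrArg g hr).trans gr, fun i => (congrArg g (hl i)).trans (gl i)⟩ }

end LabelledTree

/-- Combinatorial types of rooted trees with `n` labelled leaves. -/
def TreeType (n : ℕ) := Quotient (LabelledTree.setoid n)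

/-- The combinatorial type of a tree. -/
def LabelledTree.type {n : ℕ} (T : LabelledTree n) : TreeType n := Quotient.mk _ T

namespace TreeType

variable {n : ℕ}

/-- `τ'` is obtained from `τ` by contracting internal edges. -/
def IsContraction (τ τ' : TreeType n) : Prop :=
  ∃ T T' : LabelledTree n, T.type = τ ∧ T'.type = τ' ∧ T.IsContraction T'

/-- Types of trees with exactly one internal edge. -/
def HasOneInternalEdge (τ : TreeType n) : Prop :=
  ∃ T : LabelledTree n, T.type = τ ∧ T.internalEdges.ncard = 1

/-- The vertices of the simplex given by `τ`: the types with exactly one internal edge that are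
obtained from `τ` by contracting internal edges. -/
def vertexSet (τ : TreeType n) : Set (TreeType n) :=
  {ν | ν.HasOneInternalEdge ∧ τ.IsContraction ν}

end TreeType

/-- The types of trees on `n` leaves which are binary except at preleaves, where they are
`k`-ary. -/
def maximalTreeTypes (n k : ℕ) : Set (TreeType n) :=
  {τ | ∃ T : LabelledTree n, T.type = τ ∧ T.IsKEqualBinary k}

/-- The types of `k`-equal trees: those obtained from the maximal ones by contracting internal
edges. -/
def kEqualTreeTypes (n k : ℕ) : Set (TreeType n) :=
  {τ | ∃ μ ∈ maximalTreeTypes n k, μ.IsContraction τ}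

/-- The complex of `k`-equal trees `T_{n,k}`, generated by the simplices given by the types of
trees which are binary except at preleaves, where they are `k`-ary. -/
def kEqualTreeComplex (n k : ℕ) : PreAbstractSimplicialComplex (TreeType n) where
  faces := {s | s.Nonempty ∧ ∃ μ ∈ maximalTreeTypes n k, (s : Set (TreeType n)) ⊆ μ.vertexSet}
  isRelLowerSet_faces := by
    rintro s ⟨hne, μ, hμ, hs⟩
    exact ⟨hne, fun t ht htne => ⟨htne, μ, hμ, (Finset.coe_subset.2 ht).trans hs⟩⟩

end TreeComplex

open TreeComplex

/-! All objects are translated into laminar families of subsets of {1, …, n}.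

On the tree side, a combinatorial type is determined by its clusters, the leaf sets of its internal
vertices (`LabelledTree.equiv_iff`). The clusters form a laminar family of sets with at least 2 and
fewer than n elements, and every such family comes from a tree (`IsTreeFamily.exists_tree`).
Contracting internal edges amounts to discarding clusters (`LabelledTree.isContraction_iff`), and
internal edges are equinumerous with clusters. Hence a type with one internal edge is a single set,
and the vertex set of the simplex of a tree is its family of clusters. Trees that are binary except
at k-ary preleaves correspond exactly to the maximal laminar families of sets of size at least k and
less than n (`LabelledTree.isKEqualBinary_iff`). Since every such family extends to a maximal one,
the simplices are all the nonempty families of this kind.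

On the lattice side, the elements are the partitions whose nontrivial classes have at least k
elements. The irreducible ones have exactly one nontrivial class
(`KEqualLattice.mem_irreducibles_iff`), and a set of them is nested iff their blocks form a laminar
family (`KEqualLattice.isNested_irreducibles_iff`). Excluding the top element excludes the full set,
so both complexes have the same simplices.

For the subdivisions, the irreducibles are enlarged to all elements other than ⊥, one element at a
time, always adding a maximal missing X. Adding X subdivides the nested set complex stellarly in the
simplex of the factors of X (`IsFactorization.reducedNestedSetComplex_insert`). When only ⊥ is
missing, nested sets are chains. -/

namespace TreeComplex

/-! ### Nested set complexes of growing building sets and stellar subdivisions -/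

section Stellar

/-- Elements of `G` below an element outside of `G` lie in `I`. -/
theorem mem_of_le_of_notMem {L : Type*} [PartialOrder L] {I G : Set L} {X : L}
    (hup : ∀ x ∈ G, x ∉ I → ∀ y, x ≤ y → y ∈ G)
    (hXG : X ∉ G) {y : L} (hy : y ∈ G) (hyX : y ≤ X) : y ∈ I := by
  by_contra hyI
  exact hXG (hup y hy hyI X hyX)

variable {L : Type*} [Lattice L] [BoundedOrder L]

/-- A subset of a finset having the same join and being an antichain: its maximal elements. -/
theorem exists_antichain_sup_eq (A : Finset L) :
    ∃ M ⊆ A, IsAntichain (· ≤ ·) (M : Set L) ∧ M.sup id = A.sup id := by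
  classical
  refine ⟨A.filter fun a => Maximal (· ∈ A) a, Finset.filter_subset _ _, ?_, ?_⟩
  · intro a ha b hb hab hle
    simp only [Finset.coe_filter, Set.mem_ofPred_eq] at ha hb
    exact hab (le_antisymm hle (ha.2.2 hb.1 hle))
  · apply le_antisymm (Finset.sup_mono (Finset.filter_subset _ _))
    refine Finset.sup_le fun a ha => ?_
    obtain ⟨b, hab, hb⟩ := A.exists_le_maximal ha
    exact le_trans hab (Finset.le_sup (f := id) (by simp [hb, hb.1]))

/-- The properties of the factors of reducible elements, with respect to the set `I` of
irreducible elements, which are used for stellar subdivisions. -/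
structure IsFactorization (I : Set L) (F : L → Finset L) : Prop where
  bot_notMem : ⊥ ∉ I
  subset : ∀ X, X ≠ ⊥ → X ∉ I → (F X : Set L) ⊆ I
  antichain : ∀ X, X ≠ ⊥ → X ∉ I → IsAntichain (· ≤ ·) (F X : Set L)
  sup_eq : ∀ X, X ≠ ⊥ → X ∉ I → (F X).sup id = X
  exists_le : ∀ X, X ≠ ⊥ → X ∉ I → ∀ y ∈ I, y ≤ X → ∃ f ∈ F X, y ≤ f
  subset_of_sup_eq : ∀ X, X ≠ ⊥ → X ∉ I → ∀ A : Finset L, IsNested I A →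
    IsAntichain (· ≤ ·) (A : Set L) → A.sup id = X → F X ⊆ A

variable {I : Set L} {F : L → Finset L}

theorem IsFactorization.two_le_card (h : IsFactorization I F) {X : L} (hX : X ≠ ⊥) (hXI : X ∉ I) :
    2 ≤ (F X).card := by
  have hs := h.sup_eq X hX hXI
  by_contra hc
  rcases Nat.lt_succ_iff.1 (not_le.1 hc) |>.eq_or_lt with h1 | h0
  · obtain ⟨a, ha⟩ := Finset.card_eq_one.1 h1
    apply hXI
    rw [ha, Finset.sup_singleton] at hs
    have := h.subset X hX hXI
    rw [ha] at this
    rw [← hs]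
    exact this (by simp)
  · have := Finset.card_eq_zero.1 (Nat.lt_one_iff.1 h0)
    rw [this] at hs
    exact hX hs.symm

theorem IsNested.mono {G : Set L} {S T : Finset L} (h : IsNested G S) (hT : T ⊆ S) :
    IsNested G T :=
  ⟨(Finset.coe_subset.2 hT).trans h.1, fun A hA => h.2 A (hA.trans hT)⟩

variable {G : Set L} {X : L}

/-- Below an element outside `G`, the sets `G` and `I` have the same members, so nestedness in `G`
gives nestedness in `I` there, and the axiom on factors applies. -/
theorem IsFactorization.factor_subset (h : IsFactorization I F) (hIG : I ⊆ G)
    (hup : ∀ x ∈ G, x ∉ I → ∀ y, x ≤ y → y ∈ G) (hX : X ≠ ⊥) (hXG : X ∉ G)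
    {A : Finset L} (hA : IsNested G A) (hanti : IsAntichain (· ≤ ·) (A : Set L))
    (hsup : A.sup id = X) : F X ⊆ A := by
  have hAI : (A : Set L) ⊆ I := fun a ha =>
    mem_of_le_of_notMem hup hXG (hA.1 ha) (hsup ▸ Finset.le_sup (f := id) ha)
  exact h.subset_of_sup_eq X hX (fun hXI => hXG (hIG hXI)) A
    ⟨hAI, fun B hB h2 hBa hBI => hA.2 B hB h2 hBa (hIG hBI)⟩ hanti hsup

theorem IsFactorization.not_factor_subset (h : IsFactorization I F) (hX : X ≠ ⊥) (hXI : X ∉ I)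
    {S : Finset L} (hS : IsNested (insert X G) S) : ¬ F X ⊆ S := fun hF =>
  hS.2 (F X) hF (h.two_le_card hX hXI) (h.antichain X hX hXI)
    (by rw [h.sup_eq X hX hXI]; exact Set.mem_insert _ _)

/-- This makes the factors of `X` a simplex to subdivide in. A join of factors that lies in `G` is
below `X`, hence in `I`, hence below one factor; the antichain property then leaves only that
factor. -/
theorem IsFactorization.isNested_factor (h : IsFactorization I F) (hIG : I ⊆ G)
    (hup : ∀ x ∈ G, x ∉ I → ∀ y, x ≤ y → y ∈ G) (hX : X ≠ ⊥) (hXG : X ∉ G) :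
    IsNested G (F X) := by
  have hXI : X ∉ I := fun hXI => hXG (hIG hXI)
  refine ⟨(h.subset X hX hXI).trans hIG, fun A hA h2 _ hAG => ?_⟩
  have hle : A.sup id ≤ X := (Finset.sup_mono hA).trans (h.sup_eq X hX hXI).le
  obtain ⟨f, hf, hAf⟩ := h.exists_le X hX hXI _ (mem_of_le_of_notMem hup hXG hAG hle) hle
  have key : ∀ a ∈ A, a = f := fun a ha =>
    (h.antichain X hX hXI).eq (hA ha) hf ((Finset.le_sup (f := id) ha).trans hAf)
  have : A.card ≤ 1 := Finset.card_le_one.2 fun a ha b hb => (key a ha).trans (key b hb).symm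
  omega

-- Half of the description of the link of the new vertex: exchanging `X` for its factors turns a
-- simplex through `X` into a simplex of the old complex.
open Classical in
theorem IsFactorization.isNested_union_factor (h : IsFactorization I F) (hIG : I ⊆ G)
    (hup : ∀ x ∈ G, x ∉ I → ∀ y, x ≤ y → y ∈ G) (hX : X ≠ ⊥) (hXG : X ∉ G)
    (hmax : ∀ y, X < y → y ∈ G) {S : Finset L} (hS : IsNested (insert X G) S) (hXS : X ∈ S) :
    IsNested G (S.erase X ∪ F X) := by
  have hXI : X ∉ I := fun hXI => hXG (hIG hXI)
  -- The join of `X` with an element incomparable to it is strictly above `X`, so maximality of `X`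
  -- puts it in `G`, contradicting nestedness.
  have hcomp : ∀ a ∈ S, a ≤ X ∨ X ≤ a := by
    intro a ha
    by_contra hc
    push Not at hc
    have hne : a ≠ X := fun e => hc.1 e.le
    refine hS.2 {a, X} (by simp [Finset.insert_subset_iff, ha, hXS]) (by rw [Finset.card_pair hne])
      ?_ ?_
    · rw [Finset.coe_pair, isAntichain_insert]
      · refine ⟨IsAntichain.singleton, fun b hb _ => ?_⟩
        rw [Set.mem_singleton_iff.1 hb]
        exact hc
    · rcases (le_sup_right : X ≤ a ⊔ X).eq_or_lt with e | hlt
      · exact absurd (e ▸ le_sup_left) hc.1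
      · refine Or.inr (hmax _ ?_)
        simpa using hlt
  refine ⟨?_, fun A hA h2 hanti hAG => ?_⟩
  · intro a ha
    rcases Finset.mem_union.1 ha with ha | ha
    · exact (hS.1 (Finset.mem_of_mem_erase ha)).resolve_left (Finset.ne_of_mem_erase ha)
    · exact hIG (h.subset X hX hXI ha)
  · by_cases hAS : A ⊆ S
    · exact hS.2 A hAS h2 hanti (Or.inr hAG)
    · obtain ⟨f, hfA, hfS⟩ := Finset.not_subset.1 hAS
      have hfF : f ∈ F X := (Finset.mem_union.1 (hA hfA)).resolve_left
        fun hf => hfS (Finset.mem_of_mem_erase hf)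
      have hfX : f ≤ X := (Finset.le_sup (f := id) hfF).trans (h.sup_eq X hX hXI).le
      have hAX : ∀ a ∈ A, a ≤ X := by
        intro a ha
        rcases Finset.mem_union.1 (hA ha) with haS | haF
        · rcases hcomp a (Finset.mem_of_mem_erase haS) with hle | hle
          · exact hle
          · have := hanti.eq hfA ha (hfX.trans hle)
            exact this ▸ hfX
        · exact (Finset.le_sup (f := id) haF).trans (h.sup_eq X hX hXI).le
      have hle : A.sup id ≤ X := Finset.sup_le hAX
      obtain ⟨g, hg, hAg⟩ := h.exists_le X hX hXI _ (mem_of_le_of_notMem hup hXG hAG hle) hle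
      have hfg : f = g := (h.antichain X hX hXI).eq hfF hg
        ((Finset.le_sup (f := id) hfA).trans hAg)
      have key : ∀ a ∈ A, a = f := fun a ha =>
        hanti.eq ha hfA (((Finset.le_sup (f := id) ha).trans hAg).trans hfg.symm.le)
      have : A.card ≤ 1 := Finset.card_le_one.2 fun a ha b hb => (key a ha).trans (key b hb).symm
      omega

-- The other half of the link. An antichain containing `X` is tested after exchanging `X` for its
-- factors, which preserves the join. One without `X` could only violate nestedness anew by having
-- join `X`, and then it would contain all factors of `X`.
open Classical in
theorem IsFactorization.isNested_insert (h : IsFactorization I F) (hIG : I ⊆ G)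
    (hup : ∀ x ∈ G, x ∉ I → ∀ y, x ≤ y → y ∈ G) (hX : X ≠ ⊥) (hXG : X ∉ G)
    {ρ : Finset L} (hρ : IsNested G (ρ ∪ F X)) (hF : ¬ F X ⊆ ρ) :
    IsNested (insert X G) (insert X ρ) := by
  have hXI : X ∉ I := fun hXI => hXG (hIG hXI)
  have hρG : IsNested G ρ := hρ.mono Finset.subset_union_left
  refine ⟨?_, fun A hA h2 hanti hAG => ?_⟩
  · rw [Finset.coe_insert]
    exact Set.insert_subset_insert hρG.1
  by_cases hXA : X ∈ A
  · have hsup : A.sup id = (A.erase X ∪ F X).sup id := by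
      rw [Finset.sup_union, h.sup_eq X hX hXI]
      conv_lhs => rw [← Finset.insert_erase hXA, Finset.sup_insert]
      exact sup_comm _ _
    have hXle : X ≤ A.sup id := Finset.le_sup (f := id) hXA
    have hne : A.sup id ≠ X := by
      intro e
      have key : ∀ a ∈ A, a = X := fun a ha =>
        hanti.eq ha hXA ((Finset.le_sup (f := id) ha).trans e.le)
      have : A.card ≤ 1 := Finset.card_le_one.2 fun a ha b hb => (key a ha).trans (key b hb).symm
      omega
    have hJG : A.sup id ∈ G := hAG.resolve_left hne
    -- The join lies in `G`, so `M` must be a single element, the join itself. If it comes from `A`,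
    -- it is above `X` in an antichain containing `X`; if it is a factor, the join equals `X`. Both
    -- are excluded.
    obtain ⟨M, hM, hMa, hMs⟩ := exists_antichain_sup_eq (A.erase X ∪ F X)
    have hMsub : M ⊆ ρ ∪ F X := hM.trans (Finset.union_subset_union_left fun a ha =>
      (Finset.mem_insert.1 (hA (Finset.mem_of_mem_erase ha))).resolve_left
        (Finset.ne_of_mem_erase ha))
    have hM1 : M.card < 2 := by
      by_contra hc
      exact hρ.2 M hMsub (not_lt.1 hc) hMa (by rw [hMs, ← hsup]; exact hJG)
    have hM0 : M.Nonempty := by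
      rw [Finset.nonempty_iff_ne_empty]
      rintro rfl
      rw [← hsup] at hMs
      exact hX (le_bot_iff.1 (hXle.trans hMs.symm.le))
    obtain ⟨m, rfl⟩ := Finset.card_eq_one.1 (show M.card = 1 by
      have := hM0.card_pos; omega)
    have hm : m = A.sup id := by rw [hsup, ← hMs]; simp
    rcases Finset.mem_union.1 (hM (Finset.mem_singleton_self m)) with hmA | hmF
    · exact Finset.ne_of_mem_erase hmA
        (hanti.eq hXA (Finset.mem_of_mem_erase hmA) (hm ▸ hXle)).symm
    · exact hne (le_antisymm (hm ▸ (Finset.le_sup (f := id) hmF).trans (h.sup_eq X hX hXI).le)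
        hXle)
  · have hAρ : A ⊆ ρ := (Finset.subset_insert_iff_of_notMem hXA).1 hA
    rcases hAG with hAX | hAG
    · exact hF ((h.factor_subset hIG hup hX hXG (hρG.mono hAρ) hanti hAX).trans hAρ)
    · exact hρG.2 A hAρ h2 hanti hAG

theorem IsFactorization.isNested_of_not_subset (h : IsFactorization I F) (hIG : I ⊆ G)
    (hup : ∀ x ∈ G, x ∉ I → ∀ y, x ≤ y → y ∈ G) (hX : X ≠ ⊥) (hXG : X ∉ G)
    {S : Finset L} (hS : IsNested G S) (hF : ¬ F X ⊆ S) : IsNested (insert X G) S := by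
  refine ⟨hS.1.trans (Set.subset_insert _ _), fun A hA h2 hanti hAG => ?_⟩
  rcases hAG with hAX | hAG
  · exact hF ((h.factor_subset hIG hup hX hXG (hS.mono hA) hanti hAX).trans hA)
  · exact hS.2 A hA h2 hanti hAG

theorem IsFactorization.reducedNestedSetComplex_insert (h : IsFactorization I F) (hIG : I ⊆ G)
    (hup : ∀ x ∈ G, x ∉ I → ∀ y, x ≤ y → y ∈ G) (hX : X ≠ ⊥) (hXG : X ∉ G)
    (hmax : ∀ y, X < y → y ∈ G) (htop : ⊤ ∈ G) :
    reducedNestedSetComplex (insert X G) =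
      stellarSubdivision (reducedNestedSetComplex G) (F X) X := by
  classical
  have hXI : X ∉ I := fun hXI => hXG (hIG hXI)
  have hXtop : X ≠ ⊤ := fun e => hXG (e ▸ htop)
  have htF : ⊤ ∉ F X := fun ht => hXtop (top_le_iff.1
    ((Finset.le_sup (f := id) ht).trans (h.sup_eq X hX hXI).le))
  ext S
  constructor
  · rintro ⟨hne, hS, ht⟩
    have hF := h.not_factor_subset hX hXI hS
    by_cases hXS : X ∈ S
    · refine Or.inr ⟨S.erase X, ⟨?_, h.isNested_union_factor hIG hup hX hXG hmax hS hXS, ?_⟩,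
        fun hs => hF (hs.trans (Finset.erase_subset _ _)), ?_⟩
      · have := h.two_le_card hX hXI
        exact (Finset.card_pos.1 (by omega)).mono Finset.subset_union_right
      · rw [Finset.mem_union]
        rintro (hc | hc)
        · exact ht (Finset.mem_of_mem_erase hc)
        · exact htF hc
      · convert (Finset.insert_erase hXS).symm
    · exact Or.inl ⟨⟨hne, ⟨fun a ha => (hS.1 ha).resolve_left fun e => hXS (e ▸ ha),
        fun A hA h2 ha hAG => hS.2 A hA h2 ha (Or.inr hAG)⟩, ht⟩, hF⟩
  · rintro (⟨⟨hne, hS, ht⟩, hF⟩ | ⟨ρ, ⟨hne, hρ, ht⟩, hF, rfl⟩)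
    · exact ⟨hne, h.isNested_of_not_subset hIG hup hX hXG hS hF, ht⟩
    · have hn := h.isNested_insert hIG hup hX hXG (ρ := ρ) (by convert hρ) hF
      refine ⟨Finset.insert_nonempty _ _, by convert hn, ?_⟩
      rw [Finset.mem_insert]
      rintro (e | hc)
      · exact hXtop e.symm
      · exact ht (Finset.mem_union_left _ hc)

/-- Two incomparable elements always form a forbidden antichain here, because their join cannot be
⊥. -/
theorem reducedNestedSetComplex_compl_bot :
    reducedNestedSetComplex ({⊥}ᶜ : Set L) = orderComplex L := by
  classical
  ext S
  constructor
  · rintro ⟨hne, hS, ht⟩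
    refine ⟨hne, fun hb => hS.1 hb rfl, ht, fun a ha b hb hab => ?_⟩
    by_contra hc
    push Not at hc
    refine hS.2 {a, b} (by simp [Finset.insert_subset_iff, Finset.mem_coe.1 ha, Finset.mem_coe.1 hb])
      (by rw [Finset.card_pair hab]) ?_ ?_
    · rw [Finset.coe_pair, isAntichain_insert]
      refine ⟨IsAntichain.singleton, fun b hb _ => ?_⟩
      rw [Set.mem_singleton_iff.1 hb]
      exact hc
    · intro e
      have : a ≤ ⊥ := by
        rw [← Set.mem_singleton_iff.1 e]
        exact Finset.le_sup (f := id) (by simp)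
      exact hS.1 ha (le_bot_iff.1 this)
  · rintro ⟨hne, hb, ht, hc⟩
    refine ⟨hne, ⟨fun a ha e => hb (Set.mem_singleton_iff.1 e ▸ ha), fun A hA h2 hanti => ?_⟩, ht⟩
    obtain ⟨a, ha, b, hbA, hab⟩ := Finset.one_lt_card.1 h2
    rcases hc (hA ha) (hA hbA) hab with hle | hle
    · exact absurd (hanti.eq ha hbA hle) hab
    · exact absurd (hanti.eq hbA ha hle).symm hab

/-- Induction on the number of nonzero elements missing from the building set. The invariant that
the reducible members of `G` are upward closed in `L` survives because a maximal missing element is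
added each time. -/
theorem IsFactorization.stellar [Finite L] (h : IsFactorization I F) (htop : ⊤ ∈ I) :
    Relation.ReflTransGen IsStellarSubdivision (reducedNestedSetComplex I) (orderComplex L) := by
  suffices H : ∀ m : ℕ, ∀ G : Set L, I ⊆ G → ⊥ ∉ G →
      (∀ x ∈ G, x ∉ I → ∀ y, x ≤ y → y ∈ G) → ({⊥}ᶜ \ G).ncard = m →
      Relation.ReflTransGen IsStellarSubdivision (reducedNestedSetComplex G) (orderComplex L) from
    H _ I subset_rfl h.bot_notMem (fun x hx hxI => absurd hx hxI) rfl
  intro m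
  induction m with
  | zero =>
    intro G hIG hb hup hm
    have : G = {⊥}ᶜ := by
      apply Set.Subset.antisymm
      · intro x hx e
        exact hb (Set.mem_singleton_iff.1 e ▸ hx)
      · exact Set.sdiff_eq_empty.1 ((Set.ncard_eq_zero (Set.toFinite _)).1 hm)
    rw [this, reducedNestedSetComplex_compl_bot]
  | succ m ih =>
    intro G hIG hb hup hm
    have hne : ({⊥}ᶜ \ G).Nonempty := by
      rw [← Set.ncard_pos (Set.toFinite _)]
      omega
    obtain ⟨X, hXm⟩ := (Set.toFinite ({⊥}ᶜ \ G)).exists_maximal hne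
    have hX : X ≠ ⊥ := hXm.1.1
    have hXG : X ∉ G := hXm.1.2
    have hXI : X ∉ I := fun hXI => hXG (hIG hXI)
    have hmax : ∀ y, X < y → y ∈ G := by
      intro y hy
      by_contra hyG
      exact hy.not_ge (hXm.2 ⟨(bot_le.trans_lt hy).ne', hyG⟩ hy.le)
    refine Relation.ReflTransGen.head ?_ (ih (insert X G) (hIG.trans (Set.subset_insert _ _)) ?_ ?_ ?_)
    · refine ⟨F X, ⟨?_, h.isNested_factor hIG hup hX hXG, ?_⟩, X, ?_,
        h.reducedNestedSetComplex_insert hIG hup hX hXG hmax (hIG htop)⟩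
      · have := h.two_le_card hX hXI
        exact Finset.card_pos.1 (by omega)
      · intro ht
        have : X = ⊤ := top_le_iff.1 ((Finset.le_sup (f := id) ht).trans (h.sup_eq X hX hXI).le)
        exact hXG (this ▸ hIG htop)
      · rintro ⟨-, hn, -⟩
        exact hXG (hn.1 (by simp))
    · rintro (e | hbG)
      · exact hX e.symm
      · exact hb hbG
    · rintro x (rfl | hx) hxI y hxy
      · rcases hxy.eq_or_lt with rfl | hlt
        · exact Set.mem_insert _ _
        · exact Or.inr (hmax y hlt)
      · exact Or.inr (hup x hx hxI y hxy)
    · have : ({⊥}ᶜ \ insert X G) = ({⊥}ᶜ \ G) \ {X} := by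
        ext y
        simp only [Set.mem_sdiff, Set.mem_insert_iff, Set.mem_singleton_iff]
        tauto
      rw [this, Set.ncard_sdiff_singleton_of_mem hXm.1, hm]
      rfl

end Stellar

end TreeComplex

/-! ### Partitions with large classes -/

namespace TreeComplex

section Partitions

variable {n : ℕ}

theorem blockPartition_le_iff {B : Set (Fin n)} {π : Setoid (Fin n)} :
    blockPartition B ≤ π ↔ ∀ i ∈ B, ∀ j ∈ B, π i j := by
  constructor
  · intro h i hi j hj
    exact h (Or.inr ⟨hi, hj⟩)
  · rintro h i j (rfl | ⟨hi, hj⟩)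
    · exact π.refl' _
    · exact h i hi j hj

/-- Two elements are needed in `B`: a block of size at most one gives the trivial partition whatever
its element. -/
theorem blockPartition_le_blockPartition {B C : Set (Fin n)} (hB : 2 ≤ B.ncard) :
    blockPartition B ≤ blockPartition C ↔ B ⊆ C := by
  rw [blockPartition_le_iff]
  constructor
  · intro h i hi
    obtain ⟨j, hj, hji⟩ := Set.exists_ne_of_one_lt_ncard hB i
    rcases h i hi j hj with e | h'
    · exact absurd e.symm hji
    · exact h'.1
  · intro h i hi j hj
    exact Or.inr ⟨h hi, h hj⟩

/-- The class of `i` in a partition. -/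
def cls (π : Setoid (Fin n)) (i : Fin n) : Set (Fin n) := {j | π i j}

theorem mem_cls {π : Setoid (Fin n)} {i j : Fin n} : j ∈ cls π i ↔ π i j := Iff.rfl

theorem self_mem_cls (π : Setoid (Fin n)) (i : Fin n) : i ∈ cls π i := π.refl' i

theorem cls_eq_of_rel {π : Setoid (Fin n)} {i j : Fin n} (h : π i j) : cls π i = cls π j := by
  ext x
  exact ⟨fun hx => π.trans' (π.symm' h) hx, fun hx => π.trans' h hx⟩

theorem blockPartition_cls_le (π : Setoid (Fin n)) (i : Fin n) : blockPartition (cls π i) ≤ π :=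
  blockPartition_le_iff.2 fun _ ha _ hb => π.trans' (π.symm' ha) hb

/-- The part of a partition inside `S`; all elements outside `S` become singletons. -/
@[reducible]
def restrict (π : Setoid (Fin n)) (S : Set (Fin n)) : Setoid (Fin n) where
  r i j := i = j ∨ (i ∈ S ∧ j ∈ S ∧ π i j)
  iseqv :=
    { refl := fun _ => Or.inl rfl
      symm := by
        rintro x y (rfl | ⟨h, h', e⟩)
        · exact Or.inl rfl
        · exact Or.inr ⟨h', h, π.symm' e⟩
      trans := by
        rintro x y z (rfl | ⟨h, h', e⟩) (rfl | ⟨g, g', e'⟩)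
        · exact Or.inl rfl
        · exact Or.inr ⟨g, g', e'⟩
        · exact Or.inr ⟨h, h', e⟩
        · exact Or.inr ⟨h, g', π.trans' e e'⟩ }

/-- The partition with classes those of `σ` inside `S` and those of `τ` outside `S`. -/
@[reducible]
def glue (S : Set (Fin n)) (σ τ : Setoid (Fin n)) : Setoid (Fin n) where
  r i j := (i ∈ S ∧ j ∈ S ∧ σ i j) ∨ (i ∉ S ∧ j ∉ S ∧ τ i j)
  iseqv :=
    { refl := fun x => by
        by_cases hx : x ∈ S
        · exact Or.inl ⟨hx, hx, σ.refl' x⟩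
        · exact Or.inr ⟨hx, hx, τ.refl' x⟩
      symm := by
        rintro x y (⟨h, h', e⟩ | ⟨h, h', e⟩)
        · exact Or.inl ⟨h', h, σ.symm' e⟩
        · exact Or.inr ⟨h', h, τ.symm' e⟩
      trans := by
        rintro x y z (⟨h, h', e⟩ | ⟨h, h', e⟩) (⟨g, g', e'⟩ | ⟨g, g', e'⟩)
        · exact Or.inl ⟨h, g', σ.trans' e e'⟩
        · exact absurd h' g
        · exact absurd g h'
        · exact Or.inr ⟨h, g', τ.trans' e e'⟩ }

/-- All nontrivial classes have at least `k` elements. -/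
def HasLargeClasses (k : ℕ) (π : Setoid (Fin n)) : Prop :=
  ∀ i j, π i j → i ≠ j → k ≤ (cls π i).ncard

theorem HasLargeClasses.blockPartition {k : ℕ} {B : Set (Fin n)} (hB : k ≤ B.ncard) :
    HasLargeClasses k (blockPartition B) := by
  rintro i j (e | ⟨hi, hj⟩) hij
  · exact absurd e hij
  · exact hB.trans (Set.ncard_le_ncard (fun x hx => Or.inr ⟨hi, hx⟩) (Set.toFinite _))

theorem HasLargeClasses.restrict {k : ℕ} {π : Setoid (Fin n)} (h : HasLargeClasses k π)
    {S : Set (Fin n)} (hS : ∀ i ∈ S, ∀ j, π i j → j ∈ S) : HasLargeClasses k (restrict π S) := by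
  rintro i j (e | ⟨hi, hj, hr⟩) hij
  · exact absurd e hij
  · exact (h i j hr hij).trans
      (Set.ncard_le_ncard (fun x hx => Or.inr ⟨hi, hS i hi x hx, hx⟩) (Set.toFinite _))

theorem HasLargeClasses.glue {k : ℕ} {σ τ : Setoid (Fin n)} (hσ : HasLargeClasses k σ)
    (hτ : HasLargeClasses k τ) {S : Set (Fin n)} (hσS : ∀ i ∈ S, ∀ j, σ i j → j ∈ S)
    (hτS : ∀ i ∉ S, ∀ j, τ i j → j ∉ S) : HasLargeClasses k (glue S σ τ) := by
  rintro i j (⟨hi, hj, hr⟩ | ⟨hi, hj, hr⟩) hij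
  · exact (hσ i j hr hij).trans
      (Set.ncard_le_ncard (fun x hx => Or.inl ⟨hi, hσS i hi x hx, hx⟩) (Set.toFinite _))
  · exact (hτ i j hr hij).trans
      (Set.ncard_le_ncard (fun x hx => Or.inr ⟨hi, hτS i hi x hx, hx⟩) (Set.toFinite _))

end Partitions

/-! ### Elements of the k-equal lattice and irreducibility of single blocks -/

namespace KEqualLattice

variable {n k : ℕ}

/-- If `i` is in no generating k-block, all generators lie below the partition that isolates `i`,
and so does their join. Otherwise the class of `i` contains a k-block. -/
theorem hasLargeClasses (X : KEqualLattice n k) : HasLargeClasses k X.1 := by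
  intro i j hr hij
  obtain ⟨A, hA, hX⟩ := X.2
  by_cases h : ∃ B : Set (Fin n), B.ncard = k ∧ blockPartition B ∈ A ∧ i ∈ B
  · obtain ⟨B, hBk, hB, hi⟩ := h
    have hle : blockPartition B ≤ X.1 := hX ▸ le_sSup hB
    exact hBk.symm.le.trans
      (Set.ncard_le_ncard (fun x hx => hle (Or.inr ⟨hi, hx⟩)) (Set.toFinite _))
  · have hle : X.1 ≤ blockPartition {i}ᶜ := by
      rw [hX]
      refine sSup_le fun a ha => ?_
      obtain ⟨B, hBk, rfl⟩ := hA ha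
      have hi : i ∉ B := fun hi => h ⟨B, hBk, ha, hi⟩
      rw [blockPartition_le_iff]
      intro x hx y hy
      exact Or.inr ⟨fun e => hi (Set.mem_singleton_iff.1 e ▸ hx),
        fun e => hi (Set.mem_singleton_iff.1 e ▸ hy)⟩
    rcases hle hr with e | h'
    · exact absurd e hij
    · exact absurd rfl h'.1

/-- A partition all of whose nontrivial classes have at least `k` elements, as an element of the
`k`-equal lattice. -/
def ofLarge (hk : 2 ≤ k) (π : Setoid (Fin n)) (h : HasLargeClasses k π) : KEqualLattice n k :=
  ⟨π, {a | a ∈ kBlockPartitions n k ∧ a ≤ π}, fun _ ha => ha.1, by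
    apply le_antisymm
    · intro i j hr
      by_cases hij : i = j
      · subst hij
        exact Setoid.refl' _ _
      -- Since k is at least 2, a related pair fits into a k-subset of its class, and that k-block
      -- is one of the generators.
      · have hsub : ({i, j} : Set (Fin n)) ⊆ cls π i := by
          rintro x (rfl | rfl)
          · exact self_mem_cls _ _
          · exact hr
        obtain ⟨B, hijB, hB, hBk⟩ := Set.exists_subsuperset_card_eq hsub
          (by rw [Set.ncard_pair hij]; exact hk) (h i j hr hij)
        have hmem : blockPartition B ∈ {a | a ∈ kBlockPartitions n k ∧ a ≤ π} :=
          ⟨⟨B, hBk, rfl⟩, blockPartition_le_iff.2 fun x hx y hy =>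
            π.trans' (π.symm' (hB hx)) (hB hy)⟩
        exact le_sSup hmem (Or.inr ⟨hijB (by simp), hijB (by simp)⟩)
    · exact sSup_le fun a ha => ha.2⟩

/-- The element of the `k`-equal lattice with `B` as its only nontrivial block. -/
def block (hk : 2 ≤ k) (B : Set (Fin n)) (hB : k ≤ B.ncard) : KEqualLattice n k :=
  ofLarge hk (blockPartition B) (HasLargeClasses.blockPartition hB)

theorem le_iff {X Y : KEqualLattice n k} : X ≤ Y ↔ ∀ i j, X.1 i j → Y.1 i j :=
  ⟨fun h _ _ => @h _ _, fun h i j => h i j⟩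

theorem ext_rel {X Y : KEqualLattice n k} (h : ∀ i j, X.1 i j ↔ Y.1 i j) : X = Y :=
  Subtype.ext (Setoid.ext h)

theorem bot_rel {i j : Fin n} : (⊥ : KEqualLattice n k).1 i j ↔ i = j := by
  constructor
  · intro h
    have hle : (⊥ : KEqualLattice n k) ≤ ⟨⊥, ∅, Set.empty_subset _, sSup_empty.symm⟩ := bot_le
    exact le_iff.1 hle i j h
  · rintro rfl
    exact Setoid.refl' _ _

instance : Finite (KEqualLattice n k) :=
  Finite.of_injective (fun (X : KEqualLattice n k) (i j : Fin n) => X.1 i j) fun _ _ h =>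
    ext_rel fun i j => iff_of_eq (congrFun (congrFun h i) j)

theorem ne_bot_iff {X : KEqualLattice n k} : X ≠ ⊥ ↔ ∃ i j, i ≠ j ∧ X.1 i j := by
  constructor
  · intro h
    by_contra hc
    push Not at hc
    refine h (ext_rel fun i j => ⟨fun hr => bot_rel.2 ?_, fun e => ?_⟩)
    · by_contra hij
      exact hc i j hij hr
    · rw [bot_rel.1 e]
  · rintro ⟨i, j, hij, hr⟩ rfl
    exact hij (bot_rel.1 hr)

section

variable (hk : 2 ≤ k)

theorem block_le_iff {B : Set (Fin n)} {hB : k ≤ B.ncard} {X : KEqualLattice n k} :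
    block hk B hB ≤ X ↔ ∀ i ∈ B, ∀ j ∈ B, X.1 i j := blockPartition_le_iff

theorem block_le_block {B C : Set (Fin n)} {hB : k ≤ B.ncard} {hC : k ≤ C.ncard} :
    block hk B hB ≤ block hk C hC ↔ B ⊆ C :=
  blockPartition_le_blockPartition (hk.trans hB)

theorem block_ne_bot {B : Set (Fin n)} {hB : k ≤ B.ncard} : block hk B hB ≠ ⊥ := by
  obtain ⟨i, hi, j, hj, hij⟩ := (Set.one_lt_ncard (Set.toFinite _)).1 (hk.trans hB)
  exact ne_bot_iff.2 ⟨i, j, hij, Or.inr ⟨hi, hj⟩⟩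

theorem block_cls_le {X : KEqualLattice n k} {i : Fin n} {h : k ≤ (cls X.1 i).ncard} :
    block hk (cls X.1 i) h ≤ X := blockPartition_cls_le X.1 i

/-- Blocks of size k are atoms: a nontrivial class below has at least k elements, so it fills `C`.
-/
theorem eq_block_of_le_of_ncard_eq {C : Set (Fin n)} (hC : C.ncard = k) {Y : KEqualLattice n k}
    (hY : Y ≤ block hk C hC.ge) (hY0 : Y ≠ ⊥) : Y = block hk C hC.ge := by
  obtain ⟨i, j, hij, hr⟩ := ne_bot_iff.1 hY0
  have hiC : i ∈ C := ((le_iff.1 hY i j hr).resolve_left hij).1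
  have hsub : cls Y.1 i ⊆ C := by
    intro x hx
    rcases le_iff.1 hY i x hx with e | h
    · exact e ▸ hiC
    · exact h.2
  have hk' := Y.hasLargeClasses i j hr hij
  have heq : cls Y.1 i = C := Set.eq_of_subset_of_ncard_le hsub (by omega) (Set.toFinite _)
  refine le_antisymm hY ((block_le_iff hk).2 fun x hx y hy => ?_)
  rw [← heq] at hx hy
  exact Y.1.trans' (Y.1.symm' hx) hy

/-- A product decomposition yields complementary elements `a` and `b`, and each atom lies below one
of them. Starting from a k-set inside a class of `a`, exchanging single elements for a point `y`
outside that class produces atoms that must lie below `b`. They overlap so much that `b` also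
identifies the original k-set, contradicting that `a` and `b` have trivial meet. -/
theorem block_mem_irreducibles {B : Set (Fin n)} (hB : k ≤ B.ncard) :
    block hk B hB ∈ irreducibles (KEqualLattice n k) := by
  refine ⟨bot_lt_iff_ne_bot.2 (block_ne_bot hk), ?_⟩
  rintro P Q _ _ ⟨φ⟩
  by_contra hc
  rw [not_or, not_subsingleton_iff_nontrivial, not_subsingleton_iff_nontrivial] at hc
  obtain ⟨hP, hQ⟩ := hc
  have hbB : (⊥ : KEqualLattice n k) ≤ block hk B hB := bot_le
  let bot : Set.Icc (⊥ : KEqualLattice n k) (block hk B hB) := ⟨⊥, le_rfl, hbB⟩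
  let top : Set.Icc (⊥ : KEqualLattice n k) (block hk B hB) := ⟨_, hbB, le_rfl⟩
  have hbot : ∀ x, bot ≤ x := fun x => x.2.1
  have htop : ∀ x, x ≤ top := fun x => x.2.2
  set p₀ := (φ bot).1 with hp₀
  set q₀ := (φ bot).2 with hq₀
  set p₁ := (φ top).1 with hp₁
  set q₁ := (φ top).2 with hq₁
  have hb : ∀ p q, p₀ ≤ p ∧ q₀ ≤ q := fun p q => by
    have : φ bot ≤ (p, q) := by
      rw [← φ.apply_symm_apply (p, q), φ.le_iff_le]; exact hbot _
    exact this
  have ht : ∀ p q, p ≤ p₁ ∧ q ≤ q₁ := fun p q => by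
    have : (p, q) ≤ φ top := by
      rw [← φ.apply_symm_apply (p, q), φ.le_iff_le]; exact htop _
    exact this
  have hp : p₀ ≠ p₁ := by
    intro e
    obtain ⟨x, y, hxy⟩ := exists_pair_ne P
    have key : ∀ x, x = p₀ := fun x => le_antisymm (e ▸ (ht x q₀).1) (hb x q₀).1
    exact hxy ((key x).trans (key y).symm)
  have hq : q₀ ≠ q₁ := by
    intro e
    obtain ⟨x, y, hxy⟩ := exists_pair_ne Q
    have key : ∀ x, x = q₀ := fun x => le_antisymm (e ▸ (ht p₀ x).2) (hb p₀ x).2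
    exact hxy ((key x).trans (key y).symm)
  -- The elements `a` and `b` correspond to the pairs (top, bottom) and (bottom, top) of the
  -- product.
  set a := φ.symm (p₁, q₀) with ha
  set b := φ.symm (p₀, q₁) with hb'
  have hbots : φ.symm (p₀, q₀) = bot := by
    rw [OrderIso.symm_apply_eq]
  have htops : φ.symm (p₁, q₁) = top := by
    rw [OrderIso.symm_apply_eq]
  have disj : ∀ x, x ≤ a → x ≤ b → x = bot := by
    intro x hxa hxb
    rw [ha, OrderIso.le_symm_apply] at hxa
    rw [hb', OrderIso.le_symm_apply] at hxb
    rw [← hbots, eq_comm, OrderIso.symm_apply_eq]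
    exact Prod.ext (le_antisymm (hb (φ x).1 q₀).1 hxb.1) (le_antisymm (hb p₀ (φ x).2).2 hxa.2)
  have atoms : ∀ C : Set (Fin n), C ⊆ B → ∀ hC : C.ncard = k,
      block hk C hC.ge ≤ a.1 ∨ block hk C hC.ge ≤ b.1 := by
    intro C hCB hC
    have hle : block hk C hC.ge ≤ block hk B hB := (block_le_block hk).2 hCB
    let c : Set.Icc (⊥ : KEqualLattice n k) (block hk B hB) := ⟨_, bot_le, hle⟩
    -- The `P`-component of the atom `c`, viewed as an element below `c`, is ⊥ or `c`. In the first
    -- case `c` lies below `b`, in the second below `a`.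
    let d := φ.symm ((φ c).1, q₀)
    have hdc : d ≤ c := by
      rw [OrderIso.symm_apply_le]
      exact ⟨le_rfl, (hb (φ c).1 _).2⟩
    by_cases hd : d.1 = ⊥
    · right
      have hdb : d = bot := Subtype.ext hd
      rw [← hbots] at hdb
      have := congrArg Prod.fst (φ.symm.injective hdb)
      have hcb : c ≤ b := by
        rw [hb', OrderIso.le_symm_apply]
        exact ⟨le_of_eq this, (ht p₀ _).2⟩
      exact hcb
    · left
      have hdc' : d = c := Subtype.ext (eq_block_of_le_of_ncard_eq hk hC hdc hd)
      have hca : c ≤ a := by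
        rw [← hdc', OrderIso.symm_apply_le, ha, OrderIso.apply_symm_apply]
        exact ⟨(ht _ q₀).1, le_rfl⟩
      exact hca
  have ha0 : a.1 ≠ ⊥ := by
    intro e
    have : φ.symm (p₁, q₀) = bot := Subtype.ext e
    rw [← hbots] at this
    have he := φ.symm.injective this
    exact hp (Prod.mk.inj he).1.symm
  have haB : a.1 ≠ block hk B hB := by
    intro e
    have : φ.symm (p₁, q₀) = top := Subtype.ext e
    rw [← htops] at this
    have he := φ.symm.injective this
    exact hq (Prod.mk.inj he).2
  obtain ⟨i, j, hij, hr⟩ := ne_bot_iff.1 ha0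
  have hAk := a.1.hasLargeClasses i j hr hij
  have hAB : cls a.1.1 i ⊆ B := by
    intro x hx
    have hiB : i ∈ B := ((le_iff.1 a.2.2 i j hr).resolve_left hij).1
    rcases le_iff.1 a.2.2 i x hx with e | h
    · exact e ▸ hiB
    · exact h.2
  obtain ⟨y, hyB, hyA⟩ : ∃ y ∈ B, y ∉ cls a.1.1 i := by
    by_contra hc
    push Not at hc
    exact haB (le_antisymm a.2.2 ((block_le_iff hk).2 fun x hx z hz =>
      a.1.1.trans' (a.1.1.symm' (hc x hx)) (hc z hz)))
  obtain ⟨C, hCA, hCk⟩ := Set.exists_subset_card_eq hAk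
  obtain ⟨x, hxC, x', hx'C, hxx'⟩ := (Set.one_lt_ncard (Set.toFinite C)).1 (by omega)
  -- A k-set through `y` and a point of `C` cannot be identified by `a`, because `y` is outside the
  -- class containing `C`; so `b` identifies it.
  have notA : ∀ D : Set (Fin n), D.ncard = k → D ⊆ B → y ∈ D → ∀ z ∈ C, z ∈ D →
      ∀ w ∈ D, b.1.1 y w := by
    intro D hD hDB hyD z hzC hzD w hw
    rcases atoms D hDB hD with h | h
    · exact absurd (a.1.1.trans' (hCA hzC) ((block_le_iff hk).1 h z hzD y hyD)) hyA
    · exact (block_le_iff hk).1 h y hyD w hw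
  have hyC : y ∉ C := fun h => hyA (hCA h)
  have swap : ∀ u ∈ C, (insert y (C \ {u})).ncard = k := by
    intro u hu
    rw [Set.ncard_insert_of_notMem (fun h => hyC h.1) (Set.toFinite _),
      Set.ncard_sdiff_singleton_of_mem hu, hCk]
    omega
  have swapB : ∀ u, insert y (C \ {u}) ⊆ B := by
    rintro u z (rfl | hz)
    · exact hyB
    · exact hAB (hCA hz.1)
  -- Each `w` survives the exchange of some other point of `C`: of `x'` if `w` is `x`, and of `x`
  -- otherwise. Two distinct points exist because k is at least 2.
  have hall : ∀ w ∈ C, b.1.1 y w := by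
    intro w hw
    by_cases hwx : w = x
    · subst hwx
      exact notA _ (swap x' hx'C) (swapB x') (Set.mem_insert _ _) w hw
        (Or.inr ⟨hxC, hxx'⟩) w (Or.inr ⟨hw, hxx'⟩)
    · exact notA _ (swap x hxC) (swapB x) (Set.mem_insert _ _) x' hx'C
        (Or.inr ⟨hx'C, hxx'.symm⟩) w (Or.inr ⟨hw, hwx⟩)
  have hCa : block hk C hCk.ge ≤ a.1 := (block_le_iff hk).2 fun u hu v hv =>
    a.1.1.trans' (a.1.1.symm' (hCA hu)) (hCA hv)
  have hCb : block hk C hCk.ge ≤ b.1 := (block_le_iff hk).2 fun u hu v hv =>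
    b.1.1.trans' (b.1.1.symm' (hall u hu)) (hall v hv)
  have he := disj ⟨block hk C hCk.ge, bot_le, hCa.trans a.2.2⟩ hCa hCb
  have he' : block hk C hCk.ge = ⊥ := congrArg Subtype.val he
  exact block_ne_bot hk he'

end

end KEqualLattice

end TreeComplex

/-! ### Irreducible elements, laminar families and factorization -/

namespace TreeComplex

/-- Any two members of the family are comparable or disjoint. -/
def Laminar {α : Type*} (F : Set (Set α)) : Prop :=
  ∀ B ∈ F, ∀ C ∈ F, B ⊆ C ∨ C ⊆ B ∨ Disjoint B C

theorem Laminar.mono {α : Type*} {F G : Set (Set α)} (h : Laminar G) (hFG : F ⊆ G) : Laminar F :=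
  fun B hB C hC => h B (hFG hB) C (hFG hC)

namespace KEqualLattice

variable {n k : ℕ} (hk : 2 ≤ k)

theorem block_injective {B C : Set (Fin n)} {hB : k ≤ B.ncard} {hC : k ≤ C.ncard}
    (h : block hk B hB = block hk C hC) : B = C :=
  Set.Subset.antisymm ((block_le_block hk).1 h.le) ((block_le_block hk).1 h.ge)

theorem rel_mem_of_le {X Y : KEqualLattice n k} (h : Y ≤ X) {S : Set (Fin n)}
    (hS : ∀ i ∈ S, ∀ j, X.1 i j → j ∈ S) : ∀ i ∈ S, ∀ j, Y.1 i j → j ∈ S :=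
  fun i hi j hr => hS i hi j (le_iff.1 h i j hr)

/-- The part of an element inside a union `S` of classes. -/
def res (X : KEqualLattice n k) (S : Set (Fin n)) (hS : ∀ i ∈ S, ∀ j, X.1 i j → j ∈ S) :
    KEqualLattice n k :=
  ofLarge hk (restrict X.1 S) (X.hasLargeClasses.restrict hS)

theorem res_le_res {X Y : KEqualLattice n k} {S : Set (Fin n)} (h : Y ≤ X)
    {hS : ∀ i ∈ S, ∀ j, X.1 i j → j ∈ S} {hS' : ∀ i ∈ S, ∀ j, Y.1 i j → j ∈ S} :
    res hk Y S hS' ≤ res hk X S hS := by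
  rw [le_iff]
  rintro i j (e | ⟨hi, hj, hr⟩)
  · exact Or.inl e
  · exact Or.inr ⟨hi, hj, le_iff.1 h i j hr⟩

theorem mem_of_le_res {X Y : KEqualLattice n k} {S : Set (Fin n)}
    {hS : ∀ i ∈ S, ∀ j, X.1 i j → j ∈ S} (h : Y ≤ res hk X S hS) {i j : Fin n} (hr : Y.1 i j)
    (hij : i ≠ j) : i ∈ S ∧ j ∈ S ∧ X.1 i j :=
  (le_iff.1 h i j hr).resolve_left hij

/-- The interval below `X` is a product if the set of all labels is split into two unions of
classes. -/
def prodIso (X : KEqualLattice n k) (S : Set (Fin n)) (hS : ∀ i ∈ S, ∀ j, X.1 i j → j ∈ S)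
    (hS' : ∀ i ∈ Sᶜ, ∀ j, X.1 i j → j ∈ Sᶜ) :
    Set.Icc ⊥ X ≃o Set.Icc ⊥ (res hk X S hS) × Set.Icc ⊥ (res hk X Sᶜ hS') where
  toFun Y := (⟨res hk Y.1 S (rel_mem_of_le Y.2.2 hS), bot_le, res_le_res hk Y.2.2⟩,
    ⟨res hk Y.1 Sᶜ (rel_mem_of_le Y.2.2 hS'), bot_le, res_le_res hk Y.2.2⟩)
  invFun Z := ⟨ofLarge hk (glue S Z.1.1.1 Z.2.1.1)
    (Z.1.1.hasLargeClasses.glue Z.2.1.hasLargeClasses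
      (fun i hi j hr => by
        by_cases hij : i = j
        · exact hij ▸ hi
        · exact (mem_of_le_res hk Z.1.2.2 hr hij).2.1)
      (fun i hi j hr => by
        by_cases hij : i = j
        · exact hij ▸ hi
        · exact (mem_of_le_res hk Z.2.2.2 hr hij).2.1)), bot_le, by
    rw [le_iff]
    rintro i j (⟨hi, hj, hr⟩ | ⟨hi, hj, hr⟩)
    · by_cases hij : i = j
      · exact hij ▸ Setoid.refl' _ _
      · exact (mem_of_le_res hk Z.1.2.2 hr hij).2.2
    · by_cases hij : i = j
      · exact hij ▸ Setoid.refl' _ _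
      · exact (mem_of_le_res hk Z.2.2.2 hr hij).2.2⟩
  left_inv Y := by
    apply Subtype.ext
    apply ext_rel
    intro i j
    constructor
    · rintro (⟨hi, hj, e | ⟨-, -, hr⟩⟩ | ⟨hi, hj, e | ⟨-, -, hr⟩⟩)
      · exact e ▸ Setoid.refl' _ _
      · exact hr
      · exact e ▸ Setoid.refl' _ _
      · exact hr
    · intro hr
      by_cases hi : i ∈ S
      · have hj := rel_mem_of_le Y.2.2 hS i hi j hr
        exact Or.inl ⟨hi, hj, Or.inr ⟨hi, hj, hr⟩⟩
      · have hj := rel_mem_of_le Y.2.2 hS' i hi j hr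
        exact Or.inr ⟨hi, hj, Or.inr ⟨hi, hj, hr⟩⟩
  right_inv Z := by
    apply Prod.ext
    · apply Subtype.ext
      apply ext_rel
      intro i j
      constructor
      · rintro (e | ⟨hi, hj, ⟨-, -, hr⟩ | ⟨hi', -, -⟩⟩)
        · exact e ▸ Setoid.refl' _ _
        · exact hr
        · exact absurd hi hi'
      · intro hr
        by_cases hij : i = j
        · exact Or.inl hij
        · obtain ⟨hi, hj, -⟩ := mem_of_le_res hk Z.1.2.2 hr hij
          exact Or.inr ⟨hi, hj, Or.inl ⟨hi, hj, hr⟩⟩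
    · apply Subtype.ext
      apply ext_rel
      intro i j
      constructor
      · rintro (e | ⟨hi, hj, ⟨hi', -, -⟩ | ⟨-, -, hr⟩⟩)
        · exact e ▸ Setoid.refl' _ _
        · exact absurd hi' hi
        · exact hr
      · intro hr
        by_cases hij : i = j
        · exact Or.inl hij
        · obtain ⟨hi, hj, -⟩ := mem_of_le_res hk Z.2.2.2 hr hij
          exact Or.inr ⟨hi, hj, Or.inr ⟨hi, hj, hr⟩⟩
  map_rel_iff' {Y Z} := by
    constructor
    · rintro ⟨h1, h2⟩
      refine le_iff.2 fun i j hr => ?_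
      by_cases hij : i = j
      · exact hij ▸ Setoid.refl' _ _
      by_cases hi : i ∈ S
      · have hj := rel_mem_of_le Y.2.2 hS i hi j hr
        exact (mem_of_le_res hk (hS := rel_mem_of_le Z.2.2 hS) h1
          (show (res hk Y.1 S (rel_mem_of_le Y.2.2 hS)).1 i j from Or.inr ⟨hi, hj, hr⟩) hij).2.2
      · have hj := rel_mem_of_le Y.2.2 hS' i hi j hr
        exact (mem_of_le_res hk (hS := rel_mem_of_le Z.2.2 hS') h2
          (show (res hk Y.1 Sᶜ (rel_mem_of_le Y.2.2 hS')).1 i j from Or.inr ⟨hi, hj, hr⟩) hij).2.2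
    · intro h
      exact ⟨res_le_res hk h (hS := rel_mem_of_le Z.2.2 hS) (hS' := rel_mem_of_le Y.2.2 hS),
        res_le_res hk h (hS := rel_mem_of_le Z.2.2 hS') (hS' := rel_mem_of_le Y.2.2 hS')⟩

/-- If `X` is irreducible, split the labels into one nontrivial class and its complement. By
`prodIso` the interval is a product; the factor of the class is nontrivial, so the factor of the
complement is trivial and there is no further nontrivial class. -/
theorem mem_irreducibles_iff {X : KEqualLattice n k} :
    X ∈ irreducibles (KEqualLattice n k) ↔ ∃ B, ∃ hB : k ≤ B.ncard, X = block hk B hB := by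
  constructor
  · rintro ⟨h0, hX⟩
    obtain ⟨i, j, hij, hr⟩ := ne_bot_iff.1 (bot_lt_iff_ne_bot.1 h0)
    refine ⟨cls X.1 i, X.hasLargeClasses i j hr hij, ?_⟩
    have hS : ∀ x ∈ cls X.1 i, ∀ y, X.1 x y → y ∈ cls X.1 i := fun x hx y hy =>
      X.1.trans' hx hy
    have hS' : ∀ x ∈ (cls X.1 i)ᶜ, ∀ y, X.1 x y → y ∈ (cls X.1 i)ᶜ := fun x hx y hy hc =>
      hx (X.1.trans' hc (X.1.symm' hy))
    have key : ∀ Y : KEqualLattice n k, Subsingleton (Set.Icc ⊥ Y) → Y = ⊥ := fun Y h =>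
      congrArg Subtype.val
        (@Subsingleton.elim _ h ⟨Y, bot_le, le_rfl⟩ ⟨⊥, le_rfl, bot_le⟩)
    refine le_antisymm (le_iff.2 fun x y hxy => ?_) (block_cls_le hk)
    by_cases hxy' : x = y
    · exact Or.inl hxy'
    rcases hX _ _ ⟨prodIso hk X _ hS hS'⟩ with h | h
    · refine absurd (key _ h) (ne_bot_iff.2 ⟨i, j, hij, Or.inr ⟨self_mem_cls _ _, hr, hr⟩⟩)
    · by_cases hx : x ∈ cls X.1 i
      · exact Or.inr ⟨hx, hS x hx y hxy⟩
      · exact absurd (key _ h) (ne_bot_iff.2 ⟨x, y, hxy', Or.inr ⟨hx, hS' x hx y hxy, hxy⟩⟩)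
  · rintro ⟨B, hB, rfl⟩
    exact block_mem_irreducibles hk hB

theorem block_sup_block {B C : Set (Fin n)} {hB : k ≤ B.ncard} {hC : k ≤ C.ncard}
    (h : ¬ Disjoint B C) :
    block hk B hB ⊔ block hk C hC = block hk (B ∪ C)
      (hB.trans (Set.ncard_le_ncard Set.subset_union_left (Set.toFinite _))) := by
  apply le_antisymm
  · exact sup_le ((block_le_block hk).2 Set.subset_union_left)
      ((block_le_block hk).2 Set.subset_union_right)
  · obtain ⟨z, hzB, hzC⟩ := Set.not_disjoint_iff.1 h
    have h1 := (block_le_iff hk).1 (le_sup_left : block hk B hB ≤ block hk B hB ⊔ block hk C hC)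
    have h2 := (block_le_iff hk).1 (le_sup_right : block hk C hC ≤ block hk B hB ⊔ block hk C hC)
    have key : ∀ x ∈ B ∪ C, (block hk B hB ⊔ block hk C hC).1 z x := by
      rintro x (hx | hx)
      · exact h1 z hzB x hx
      · exact h2 z hzC x hx
    exact (block_le_iff hk).2 fun x hx y hy =>
      Setoid.trans' _ (Setoid.symm' _ (key x hx)) (key y hy)

/-- The family of the nontrivial blocks of the irreducible elements of `A`. -/
def blocks (A : Finset (KEqualLattice n k)) : Set (Set (Fin n)) :=
  {B | ∃ hB : k ≤ B.ncard, block hk B hB ∈ A}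

/-- For pairwise disjoint blocks, lying in a common block (or being equal) is already an equivalence
relation. Its nontrivial classes are large, so it is an element of the lattice and bounds the join.
-/
theorem sup_rel {A : Finset (KEqualLattice n k)}
    (hA : (A : Set (KEqualLattice n k)) ⊆ irreducibles (KEqualLattice n k))
    (hd : ∀ B ∈ blocks hk A, ∀ C ∈ blocks hk A, ¬ Disjoint B C → B = C) {i j : Fin n}
    (hr : (A.sup id).1 i j) : i = j ∨ ∃ B ∈ blocks hk A, i ∈ B ∧ j ∈ B := by
  let π : Setoid (Fin n) :=
    { r := fun i j => i = j ∨ ∃ B ∈ blocks hk A, i ∈ B ∧ j ∈ B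
      iseqv :=
        { refl := fun _ => Or.inl rfl
          symm := by
            rintro x y (rfl | ⟨B, hB, hx, hy⟩)
            · exact Or.inl rfl
            · exact Or.inr ⟨B, hB, hy, hx⟩
          trans := by
            rintro x y z (rfl | ⟨B, hB, hx, hy⟩) (rfl | ⟨C, hC, hy', hz⟩)
            · exact Or.inl rfl
            · exact Or.inr ⟨C, hC, hy', hz⟩
            · exact Or.inr ⟨B, hB, hx, hy⟩
            · obtain rfl := hd B hB C hC (Set.not_disjoint_iff.2 ⟨y, hy, hy'⟩)
              exact Or.inr ⟨B, hB, hx, hz⟩ } }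
  have hπ : HasLargeClasses k π := by
    rintro x y (e | ⟨B, hB, hx, hy⟩) hxy
    · exact absurd e hxy
    · exact hB.1.trans
        (Set.ncard_le_ncard (fun z hz => Or.inr ⟨B, hB, hx, hz⟩) (Set.toFinite _))
  have hle : A.sup id ≤ ofLarge hk π hπ := by
    refine Finset.sup_le fun a ha => ?_
    obtain ⟨B, hB, rfl⟩ := (mem_irreducibles_iff hk).1 (hA ha)
    exact (block_le_iff hk).2 fun x hx y hy => Or.inr ⟨B, ⟨hB, ha⟩, hx, hy⟩
  exact le_iff.1 hle i j hr

/-- Two overlapping incomparable blocks have their union as join, which is again a single block.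
Conversely, the blocks of an antichain in a laminar family are disjoint, and the join of at least
two of them never merges them, so it is not a single block. -/
theorem isNested_irreducibles_iff {A : Finset (KEqualLattice n k)} :
    IsNested (irreducibles (KEqualLattice n k)) A ↔
      (A : Set (KEqualLattice n k)) ⊆ irreducibles (KEqualLattice n k) ∧
        Laminar (blocks hk A) := by
  classical
  constructor
  · rintro ⟨hA, h⟩
    refine ⟨hA, ?_⟩
    rintro B ⟨hB, hBA⟩ C ⟨hC, hCA⟩
    by_contra hc
    push Not at hc
    obtain ⟨h1, h2, h3⟩ := hc
    refine h {block hk B hB, block hk C hC} (by simp [Finset.insert_subset_iff, hBA, hCA])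
      ?_ ?_ ?_
    · rw [Finset.card_pair]
      exact fun e => h1 ((block_le_block hk).1 e.le)
    · rw [Finset.coe_pair, isAntichain_insert]
      refine ⟨IsAntichain.singleton, fun b hb _ => ?_⟩
      rw [Set.mem_singleton_iff.1 hb, block_le_block, block_le_block]
      exact ⟨h1, h2⟩
    · rw [Finset.sup_insert, Finset.sup_singleton, id, id, block_sup_block hk h3]
      exact block_mem_irreducibles hk _
  · rintro ⟨hA, hlam⟩
    refine ⟨hA, fun M hM h2 hanti hMI => ?_⟩
    have hMA : blocks hk M ⊆ blocks hk A := fun B hB => ⟨hB.1, hM hB.2⟩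
    have hd : ∀ B ∈ blocks hk M, ∀ C ∈ blocks hk M, ¬ Disjoint B C → B = C := by
      intro B hB C hC hBC
      rcases hlam B (hMA hB) C (hMA hC) with h | h | h
      · exact block_injective hk (hanti.eq hB.2 hC.2 ((block_le_block hk).2 h))
      · exact (block_injective hk (hanti.eq hC.2 hB.2 ((block_le_block hk).2 h))).symm
      · exact absurd h hBC
    obtain ⟨D, hD, hMD⟩ := (mem_irreducibles_iff hk).1 hMI
    have hsub : ∀ B ∈ blocks hk M, B ⊆ D := fun B hB =>
      (block_le_block hk (hB := hB.1) (hC := hD)).1 (hMD ▸ Finset.le_sup (f := id) hB.2)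
    obtain ⟨a, ha, b, hb, hab⟩ := Finset.one_lt_card.1 h2
    obtain ⟨B, hB, rfl⟩ := (mem_irreducibles_iff hk).1 (hA (hM ha))
    obtain ⟨C, hC, rfl⟩ := (mem_irreducibles_iff hk).1 (hA (hM hb))
    have hBM : B ∈ blocks hk M := ⟨hB, ha⟩
    have hCM : C ∈ blocks hk M := ⟨hC, hb⟩
    have hBC : Disjoint B C := by
      by_contra hc
      obtain rfl := hd B hBM C hCM hc
      exact hab rfl
    obtain ⟨i, hi⟩ := (Set.ncard_pos (Set.toFinite B)).1 (by omega)
    obtain ⟨j, hj⟩ := (Set.ncard_pos (Set.toFinite C)).1 (by omega)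
    have hr : (M.sup id).1 i j := by
      rw [hMD]
      exact Or.inr ⟨hsub B hBM hi, hsub C hCM hj⟩
    rcases sup_rel hk ((Finset.coe_subset.2 hM).trans hA) hd hr with rfl | ⟨E, hE, hiE, hjE⟩
    · exact Set.disjoint_left.1 hBC hi hj
    · obtain rfl := hd B hBM E hE (Set.not_disjoint_iff.2 ⟨i, hi, hiE⟩)
      exact Set.disjoint_left.1 hBC hjE hj

/-- The irreducible elements given by the nontrivial classes of `X`. -/
noncomputable def factors (X : KEqualLattice n k) : Finset (KEqualLattice n k) :=
  (Set.toFinite {f | ∃ i, ∃ h : k ≤ (cls X.1 i).ncard, f = block hk (cls X.1 i) h}).toFinset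

theorem mem_factors {X f : KEqualLattice n k} :
    f ∈ factors hk X ↔ ∃ i, ∃ h : k ≤ (cls X.1 i).ncard, f = block hk (cls X.1 i) h := by
  simp [factors]

/-- The factors of `X` are its nontrivial classes. A single block below `X` lies in one class. A
nested antichain with join `X` consists of disjoint blocks, so by `sup_rel` every nontrivial class
of `X` is one of them. -/
theorem isFactorization_factors :
    IsFactorization (irreducibles (KEqualLattice n k)) (factors hk) where
  bot_notMem h := lt_irrefl _ h.1
  subset X _ _ f hf := by
    obtain ⟨i, h, rfl⟩ := (mem_factors hk).1 hf
    exact block_mem_irreducibles hk h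
  antichain X _ _ f hf g hg hfg hle := by
    obtain ⟨i, h, rfl⟩ := (mem_factors hk).1 hf
    obtain ⟨j, h', rfl⟩ := (mem_factors hk).1 hg
    have := cls_eq_of_rel (mem_cls.1 ((block_le_block hk).1 hle (self_mem_cls _ i)))
    refine hfg (le_antisymm hle ((block_le_block hk).2 this.le))
  sup_eq X _ _ := by
    apply le_antisymm
    · refine Finset.sup_le fun f hf => ?_
      obtain ⟨i, h, rfl⟩ := (mem_factors hk).1 hf
      exact block_cls_le hk
    · refine le_iff.2 fun i j hr => ?_
      by_cases hij : i = j
      · exact hij ▸ Setoid.refl' _ _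
      · have hle : block hk (cls X.1 i) (X.hasLargeClasses i j hr hij) ≤ (factors hk X).sup id :=
          Finset.le_sup (f := id) ((mem_factors hk).2 ⟨i, X.hasLargeClasses i j hr hij, rfl⟩)
        exact (block_le_iff hk).1 hle i (self_mem_cls _ _) j hr
  exists_le X _ _ y hy hyX := by
    obtain ⟨B, hB, rfl⟩ := (mem_irreducibles_iff hk).1 hy
    obtain ⟨i, hi⟩ := (Set.ncard_pos (Set.toFinite B)).1 (by omega)
    have hsub : B ⊆ cls X.1 i := fun j hj => (block_le_iff hk).1 hyX i hi j hj
    exact ⟨_, (mem_factors hk).2 ⟨i, hB.trans (Set.ncard_le_ncard hsub (Set.toFinite _)), rfl⟩,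
      (block_le_block hk).2 hsub⟩
  subset_of_sup_eq X _ _ A hA hanti hsup f hf := by
    obtain ⟨i, h, rfl⟩ := (mem_factors hk).1 hf
    obtain ⟨hAI, hlam⟩ := (isNested_irreducibles_iff hk).1 hA
    have hd : ∀ B ∈ blocks hk A, ∀ C ∈ blocks hk A, ¬ Disjoint B C → B = C := by
      intro B hB C hC hBC
      rcases hlam B hB C hC with h | h | h
      · exact block_injective hk (hanti.eq hB.2 hC.2 ((block_le_block hk).2 h))
      · exact (block_injective hk (hanti.eq hC.2 hB.2 ((block_le_block hk).2 h))).symm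
      · exact absurd h hBC
    have hrel : ∀ {i j}, X.1 i j → i = j ∨ ∃ B ∈ blocks hk A, i ∈ B ∧ j ∈ B := fun hr =>
      sup_rel hk hAI hd (by rw [hsup]; exact hr)
    -- A second element of the class is needed to force `i` into some block of `A`.
    obtain ⟨j, hj, hji⟩ := Set.exists_ne_of_one_lt_ncard (lt_of_lt_of_le (by omega) h) i
    rcases hrel hj with e | ⟨B, hB, hi, -⟩
    · exact absurd e.symm hji
    · have hBX : block hk B hB.1 ≤ X := hsup ▸ Finset.le_sup (f := id) hB.2
      have heq : cls X.1 i = B := by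
        apply Set.Subset.antisymm
        · intro x hx
          rcases hrel hx with e | ⟨C, hC, hiC, hxC⟩
          · exact e ▸ hi
          · obtain rfl := hd B hB C hC (Set.not_disjoint_iff.2 ⟨i, hi, hiC⟩)
            exact hxC
        · exact fun x hx => (block_le_iff hk).1 hBX i hi x hx
      have key : ∀ C (hC : k ≤ C.ncard), C = B → block hk C hC ∈ A := by
        rintro C hC rfl
        exact hB.2
      exact key _ h heq

theorem top_eq_block (hkn : k ≤ n) :
    (⊤ : KEqualLattice n k) = block hk Set.univ (by simpa [Set.ncard_univ] using hkn) :=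
  (top_le_iff.1 (le_iff.2 fun _ _ _ => Or.inr ⟨trivial, trivial⟩)).symm

theorem stellar (hk : 2 ≤ k) (hkn : k ≤ n) :
    Relation.ReflTransGen IsStellarSubdivision
      (reducedNestedSetComplex (irreducibles (KEqualLattice n k)))
      (orderComplex (KEqualLattice n k)) :=
  (isFactorization_factors hk).stellar (top_eq_block hk hkn ▸ block_mem_irreducibles hk _)

end KEqualLattice

end TreeComplex

/-! ### The order of a rooted tree and its leaf sets -/

namespace TreeComplex
namespace LabelledTree

open SimpleGraph

variable {n : ℕ} (T : LabelledTree n)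

instance : Finite T.V := T.finite

/-- The path from a vertex to the root. -/
noncomputable def path (v : T.V) : T.graph.Walk v T.root :=
  (T.isTree.existsUnique_path v T.root).choose

theorem isPath_path (v : T.V) : (T.path v).IsPath :=
  (T.isTree.existsUnique_path v T.root).choose_spec.1

variable {T}

theorem eq_path {v : T.V} {p : T.graph.Walk v T.root} (hp : p.IsPath) : p = T.path v :=
  (T.isTree.existsUnique_path v T.root).choose_spec.2 p hp

theorem below_iff {v t : T.V} : T.Below v t ↔ t ∈ (T.path v).support :=
  ⟨fun h => h _ (T.isPath_path v), fun h _ hp => eq_path hp ▸ h⟩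

variable (T) in
/-- The distance of a vertex from the root. -/
noncomputable def depth (v : T.V) : ℕ := (T.path v).length

variable (T) in
/-- The next vertex on the path to the root. -/
noncomputable def parent (v : T.V) : T.V := (T.path v).snd

theorem path_root : T.path T.root = Walk.nil := (eq_path Walk.IsPath.nil).symm

theorem path_cons {u v : T.V} (h : T.graph.Adj u v) (hu : ¬ T.Below v u) :
    T.path u = Walk.cons h (T.path v) :=
  (eq_path ((T.isPath_path v).cons (fun hc => hu (below_iff.2 hc)))).symm

theorem below_refl (v : T.V) : T.Below v v := below_iff.2 (Walk.start_mem_support _)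

theorem below_root (v : T.V) : T.Below v T.root := below_iff.2 (Walk.end_mem_support _)

theorem depth_lt_of_below {v t : T.V} (h : T.Below v t) (hne : v ≠ t) : T.depth t < T.depth v := by
  classical
  have ht := below_iff.1 h
  have hd : (T.path v).dropUntil t ht = T.path t := eq_path ((T.isPath_path v).dropUntil ht)
  have := congrArg Walk.length ((T.path v).take_spec ht)
  rw [Walk.length_append, hd] at this
  have h0 : ((T.path v).takeUntil t ht).length ≠ 0 := fun h0 => hne (Walk.eq_of_length_eq_zero h0)
  unfold depth
  omega

theorem exists_path_eq_cons {v : T.V} (hv : v ≠ T.root) :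
    ∃ h : T.graph.Adj v (T.parent v), T.path v = Walk.cons h (T.path (T.parent v)) := by
  have hp := T.isPath_path v
  unfold parent
  generalize T.path v = p at hp
  cases p with
  | nil => exact absurd rfl hv
  | cons h q =>
    rw [Walk.snd_cons]
    refine ⟨h, ?_⟩
    rw [eq_path hp.of_cons]

theorem adj_parent {v : T.V} (hv : v ≠ T.root) : T.graph.Adj v (T.parent v) :=
  (exists_path_eq_cons hv).choose

theorem depth_eq {v : T.V} (hv : v ≠ T.root) : T.depth v = T.depth (T.parent v) + 1 := by
  obtain ⟨h, hp⟩ := exists_path_eq_cons hv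
  unfold depth
  rw [hp, Walk.length_cons]

theorem below_iff_parent {v t : T.V} (hv : v ≠ T.root) :
    T.Below v t ↔ t = v ∨ T.Below (T.parent v) t := by
  obtain ⟨h, hp⟩ := exists_path_eq_cons hv
  rw [below_iff, hp, Walk.support_cons, List.mem_cons, ← below_iff]

theorem root_below_iff {t : T.V} : T.Below T.root t ↔ t = T.root := by
  rw [below_iff, path_root, Walk.support_nil, List.mem_singleton]

theorem below_parent {v : T.V} (hv : v ≠ T.root) : T.Below v (T.parent v) :=
  (below_iff_parent hv).2 (Or.inr (below_refl _))

/-- Induction on the distance from the root; it replaces arguments with explicit paths from here on.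
-/
theorem root_induction {P : T.V → Prop} (root : P T.root)
    (step : ∀ v, v ≠ T.root → P (T.parent v) → P v) (v : T.V) : P v := by
  suffices ∀ m v, T.depth v = m → P v from this _ v rfl
  intro m
  induction m with
  | zero =>
    intro v hv
    by_cases h : v = T.root
    · exact h ▸ root
    · have := depth_eq h
      omega
  | succ m ih =>
    intro v hv
    by_cases h : v = T.root
    · exact h ▸ root
    · refine step v h (ih _ ?_)
      have := depth_eq h
      omega

theorem below_trans {u v w : T.V} (h : T.Below u v) (h' : T.Below v w) : T.Below u w := by
  revert h
  induction u using root_induction with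
  | root =>
    intro h
    rw [root_below_iff] at h
    exact h ▸ h'
  | step u hu ih =>
    intro h
    rcases (below_iff_parent hu).1 h with rfl | h
    · exact h'
    · exact (below_iff_parent hu).2 (Or.inr (ih h))

theorem below_antisymm {u v : T.V} (h : T.Below u v) (h' : T.Below v u) : u = v := by
  by_contra hne
  have h1 := depth_lt_of_below h hne
  have h2 := depth_lt_of_below h' (Ne.symm hne)
  omega

theorem below_total {u v w : T.V} (hv : T.Below u v) (hw : T.Below u w) :
    T.Below v w ∨ T.Below w v := by
  revert hv hw
  induction u using root_induction with
  | root =>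
    intro hv hw
    rw [root_below_iff] at hv hw
    subst hv hw
    exact Or.inl (below_refl _)
  | step u hu ih =>
    intro hv hw
    rcases (below_iff_parent hu).1 hv with rfl | hv'
    · exact Or.inl hw
    · rcases (below_iff_parent hu).1 hw with rfl | hw'
      · exact Or.inr hv
      · exact ih hv' hw'

theorem adj_iff {u v : T.V} : T.graph.Adj u v ↔
    (u ≠ T.root ∧ T.parent u = v) ∨ (v ≠ T.root ∧ T.parent v = u) := by
  have key : ∀ {u v : T.V}, T.graph.Adj u v → ¬ T.Below v u → u ≠ T.root ∧ T.parent u = v := by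
    intro u v h hu
    refine ⟨?_, ?_⟩
    · rintro rfl
      exact hu (below_root v)
    · unfold parent
      rw [path_cons h hu, Walk.snd_cons]
  constructor
  · intro h
    by_cases hu : T.Below v u
    · refine Or.inr (key h.symm fun hv => h.ne (below_antisymm hv hu))
    · exact Or.inl (key h hu)
  · rintro (⟨hu, rfl⟩ | ⟨hv, rfl⟩)
    · exact adj_parent hu
    · exact (adj_parent hv).symm

/-- Used to recognize the parent map of a constructed tree. If the edge from `v` to `f v` pointed
the other way, `v` would be the parent of `f v`, hence by induction equal to `f (f v)`, where `d` is
too small. -/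
theorem parent_eq_of_decreasing {f : T.V → T.V} {d : T.V → ℕ}
    (hf : ∀ v, v ≠ T.root → T.graph.Adj v (f v)) (hd : ∀ v, v ≠ T.root → d (f v) < d v)
    (v : T.V) (hv : v ≠ T.root) : T.parent v = f v := by
  suffices ∀ m v, v ≠ T.root → d v = m → T.parent v = f v from this _ v hv rfl
  intro m
  induction m using Nat.strong_induction_on with
  | _ m ih =>
    rintro v hv rfl
    rcases adj_iff.1 (hf v hv) with h | ⟨hr, h⟩
    · exact h.2
    · have h1 := hd v hv
      have h2 := ih _ h1 (f v) hr rfl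
      have h3 := hd (f v) hr
      rw [← h2, h] at h3
      omega

theorem mem_children {v w : T.V} : w ∈ T.children v ↔ w ≠ T.root ∧ T.parent w = v := by
  constructor
  · rintro ⟨h, hb⟩
    rcases adj_iff.1 h with ⟨hv, rfl⟩ | h
    · exact absurd (below_parent hv) hb
    · exact h
  · rintro ⟨hw, rfl⟩
    exact ⟨(adj_parent hw).symm, fun h => (adj_parent hw).ne (below_antisymm (below_parent hw) h)⟩

theorem neighborSet_eq {v : T.V} (hv : v ≠ T.root) :
    T.graph.neighborSet v = insert (T.parent v) (T.children v) := by
  ext w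
  rw [mem_neighborSet, adj_iff, Set.mem_insert_iff, mem_children]
  constructor
  · rintro (⟨-, h⟩ | h)
    · exact Or.inl h.symm
    · exact Or.inr h
  · rintro (h | h)
    · exact Or.inl ⟨hv, h.symm⟩
    · exact Or.inr h

theorem neighborSet_root : T.graph.neighborSet T.root = T.children T.root := by
  ext w
  rw [mem_neighborSet, adj_iff, mem_children]
  constructor
  · rintro (⟨h, -⟩ | h)
    · exact absurd rfl h
    · exact h
  · exact Or.inr

theorem ncard_neighborSet {v : T.V} (hv : v ≠ T.root) :
    (T.graph.neighborSet v).ncard = (T.children v).ncard + 1 := by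
  rw [neighborSet_eq hv, Set.ncard_insert_of_notMem _ (Set.toFinite _)]
  rw [mem_children]
  rintro ⟨h, e⟩
  have h1 := depth_eq hv
  have h2 := depth_eq h
  rw [e] at h2
  omega

theorem isLeaf_iff_ncard {v : T.V} : T.IsLeaf v ↔ (T.graph.neighborSet v).ncard = 1 := by
  unfold IsLeaf
  rw [T.range_leaf]
  rfl

theorem IsLeaf.ne_root {v : T.V} (h : T.IsLeaf v) : v ≠ T.root := by
  rintro rfl
  have := isLeaf_iff_ncard.1 h
  have := T.two_le_degree_root
  omega

theorem isLeaf_leaf (i : Fin n) : T.IsLeaf (T.leaf i) := ⟨i, rfl⟩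

theorem IsLeaf.children_eq {v : T.V} (h : T.IsLeaf v) : T.children v = ∅ := by
  have h1 := isLeaf_iff_ncard.1 h
  rw [ncard_neighborSet h.ne_root] at h1
  exact (Set.ncard_eq_zero (Set.toFinite _)).1 (by omega)

theorem two_le_outdegree {v : T.V} (h : ¬ T.IsLeaf v) : 2 ≤ (T.children v).ncard := by
  by_cases hv : v = T.root
  · subst hv
    rw [← neighborSet_root]
    exact T.two_le_degree_root
  · have := T.three_le_degree v h hv
    rw [ncard_neighborSet hv] at this
    omega

theorem not_isLeaf_parent {v : T.V} (hv : v ≠ T.root) : ¬ T.IsLeaf (T.parent v) := by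
  intro h
  have : v ∈ T.children (T.parent v) := mem_children.2 ⟨hv, rfl⟩
  rw [h.children_eq] at this
  exact this

theorem exists_child_of_below {w v : T.V} (h : T.Below w v) (hne : w ≠ v) :
    ∃ c ∈ T.children v, T.Below w c := by
  revert h hne
  induction w using root_induction with
  | root =>
    intro h hne
    exact absurd (root_below_iff.1 h).symm hne
  | step w hw ih =>
    intro h hne
    have h' := ((below_iff_parent hw).1 h).resolve_left (Ne.symm hne)
    by_cases hp : T.parent w = v
    · exact ⟨w, mem_children.2 ⟨hw, hp⟩, below_refl w⟩
    · obtain ⟨c, hc, hwc⟩ := ih h' hp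
      exact ⟨c, hc, below_trans (below_parent hw) hwc⟩

theorem below_of_mem_children {v c : T.V} (hc : c ∈ T.children v) : T.Below c v := by
  obtain ⟨h, rfl⟩ := mem_children.1 hc
  exact below_parent h

theorem ne_of_mem_children {v c : T.V} (hc : c ∈ T.children v) : c ≠ v := hc.1.ne'

theorem children_eq_of_below {v c c' x : T.V} (hc : c ∈ T.children v) (hc' : c' ∈ T.children v)
    (h : T.Below x c) (h' : T.Below x c') : c = c' := by
  have key : ∀ {a b : T.V}, a ∈ T.children v → b ∈ T.children v → T.Below a b → a = b := by
    intro a b ha hb hab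
    obtain ⟨har, hav⟩ := mem_children.1 ha
    rcases (below_iff_parent har).1 hab with e | hvb
    · exact e.symm
    · exact absurd (hav ▸ hvb) hb.2
  rcases below_total h h' with h1 | h1
  · exact key hc hc' h1
  · exact (key hc' hc h1).symm

theorem exists_leaf_below (v : T.V) : ∃ i, T.Below (T.leaf i) v := by
  obtain ⟨w, hw⟩ := Set.Finite.exists_maximalFor T.depth {w | T.Below w v} (Set.toFinite _)
    ⟨v, below_refl v⟩
  by_cases h : T.IsLeaf w
  · obtain ⟨i, rfl⟩ := h
    exact ⟨i, hw.1⟩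
  · obtain ⟨c, hc⟩ := (Set.ncard_pos (Set.toFinite _)).1
      (lt_of_lt_of_le Nat.zero_lt_two (two_le_outdegree h))
    have h1 := hw.2 (below_trans (below_of_mem_children hc) hw.1 : T.Below c v)
      (depth_lt_of_below (below_of_mem_children hc) (ne_of_mem_children hc)).le
    have h2 := depth_lt_of_below (below_of_mem_children hc) (ne_of_mem_children hc)
    omega

theorem mem_leavesBelow {t : T.V} {i : Fin n} : i ∈ T.leavesBelow t ↔ T.Below (T.leaf i) t :=
  Iff.rfl

theorem leavesBelow_nonempty (t : T.V) : (T.leavesBelow t).Nonempty := exists_leaf_below t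

theorem leavesBelow_mono {t t' : T.V} (h : T.Below t t') : T.leavesBelow t ⊆ T.leavesBelow t' :=
  fun _ hi => below_trans hi h

theorem exists_child_not_below {v x : T.V} (hv : ¬ T.IsLeaf v) :
    ∃ c ∈ T.children v, ¬ T.Below x c := by
  obtain ⟨a, ha, b, hb, hab⟩ := (Set.one_lt_ncard (Set.toFinite _)).1 (two_le_outdegree hv)
  by_cases h : T.Below x a
  · exact ⟨b, hb, fun h' => hab (children_eq_of_below ha hb h h')⟩
  · exact ⟨a, ha, h⟩

/-- Leaf sets determine the order because every non-leaf has at least two children: if `t'` were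
strictly below `t`, another child of `t` would carry a leaf that is not below `t'`. -/
theorem leavesBelow_subset_iff {t t' : T.V} :
    T.leavesBelow t ⊆ T.leavesBelow t' ↔ T.Below t t' := by
  refine ⟨fun h => ?_, leavesBelow_mono⟩
  obtain ⟨i, hi⟩ := T.leavesBelow_nonempty t
  rcases below_total hi (h hi) with h1 | h1
  · exact h1
  by_cases hne : t' = t
  · exact hne ▸ below_refl _
  obtain ⟨c, hc, hc'⟩ := exists_child_of_below h1 hne
  have hl : ¬ T.IsLeaf t := by
    intro hl
    rw [hl.children_eq] at hc
    exact hc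
  obtain ⟨d, hd, hd'⟩ := exists_child_not_below (x := t') hl
  obtain ⟨j, hj⟩ := T.leavesBelow_nonempty d
  have hj' := h (leavesBelow_mono (below_of_mem_children hd) hj)
  exact absurd hc' (fun hc' => hd' (by
    rwa [children_eq_of_below hd hc hj (below_trans hj' hc')]))

theorem leavesBelow_injective : Function.Injective T.leavesBelow := fun _ _ h =>
  below_antisymm (leavesBelow_subset_iff.1 h.le) (leavesBelow_subset_iff.1 h.ge)

theorem leavesBelow_root : T.leavesBelow T.root = Set.univ :=
  Set.eq_univ_of_forall fun _ => below_root _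

theorem IsLeaf.below_iff {v w : T.V} (h : T.IsLeaf v) : T.Below w v ↔ w = v := by
  refine ⟨fun hw => ?_, fun e => e ▸ below_refl _⟩
  by_contra hne
  obtain ⟨c, hc, -⟩ := exists_child_of_below hw hne
  rw [h.children_eq] at hc
  exact hc

theorem leavesBelow_leaf (i : Fin n) : T.leavesBelow (T.leaf i) = {i} := by
  ext j
  rw [mem_leavesBelow, (isLeaf_leaf i).below_iff, T.leaf_injective.eq_iff]
  rfl

theorem leavesBelow_comparable (s t : T.V) :
    T.leavesBelow s ⊆ T.leavesBelow t ∨ T.leavesBelow t ⊆ T.leavesBelow s ∨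
      Disjoint (T.leavesBelow s) (T.leavesBelow t) := by
  by_cases h : Disjoint (T.leavesBelow s) (T.leavesBelow t)
  · exact Or.inr (Or.inr h)
  · obtain ⟨i, hi, hi'⟩ := Set.not_disjoint_iff.1 h
    rcases below_total hi hi' with h1 | h1
    · exact Or.inl (leavesBelow_mono h1)
    · exact Or.inr (Or.inl (leavesBelow_mono h1))

theorem two_le_ncard_leavesBelow {t : T.V} (h : ¬ T.IsLeaf t) : 2 ≤ (T.leavesBelow t).ncard := by
  obtain ⟨a, ha, b, hb, hab⟩ := (Set.one_lt_ncard (Set.toFinite _)).1 (two_le_outdegree h)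
  obtain ⟨i, hi⟩ := T.leavesBelow_nonempty a
  obtain ⟨j, hj⟩ := T.leavesBelow_nonempty b
  refine (Set.one_lt_ncard (Set.toFinite _)).2
    ⟨i, leavesBelow_mono (below_of_mem_children ha) hi, j,
      leavesBelow_mono (below_of_mem_children hb) hj, ?_⟩
  rintro rfl
  exact hab (children_eq_of_below ha hb hi hj)

variable (T) in
/-- The family of the sets of leaves below the internal vertices. -/
def clusters : Set (Set (Fin n)) := {B | ∃ t, T.IsInternal t ∧ T.leavesBelow t = B}

theorem laminar_clusters : Laminar T.clusters := by
  rintro _ ⟨s, -, rfl⟩ _ ⟨t, -, rfl⟩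
  exact leavesBelow_comparable s t

theorem ncard_lt_of_ne_univ {B : Set (Fin n)} (h : B ≠ Set.univ) : B.ncard < n := by
  have := Set.ncard_lt_ncard (Set.ssubset_univ_iff.2 h) (Set.toFinite _)
  rwa [Set.ncard_univ, Nat.card_eq_fintype_card, Fintype.card_fin] at this

theorem ncard_of_mem_clusters {B : Set (Fin n)} (h : B ∈ T.clusters) :
    2 ≤ B.ncard ∧ B.ncard < n := by
  obtain ⟨t, ht, rfl⟩ := h
  refine ⟨two_le_ncard_leavesBelow ht.1, ncard_lt_of_ne_univ fun h => ht.2 ?_⟩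
  rw [← leavesBelow_root] at h
  exact leavesBelow_injective h

theorem range_leavesBelow :
    Set.range T.leavesBelow = insert Set.univ (T.clusters ∪ Set.range fun i => {i}) := by
  ext B
  constructor
  · rintro ⟨t, rfl⟩
    by_cases hr : t = T.root
    · exact Or.inl (hr ▸ leavesBelow_root)
    · by_cases hl : T.IsLeaf t
      · obtain ⟨i, rfl⟩ := hl
        exact Or.inr (Or.inr ⟨i, (leavesBelow_leaf i).symm⟩)
      · exact Or.inr (Or.inl ⟨t, ⟨hl, hr⟩, rfl⟩)
  · rintro (rfl | ⟨t, -, rfl⟩ | ⟨i, rfl⟩)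
    · exact ⟨_, leavesBelow_root⟩
    · exact ⟨t, rfl⟩
    · exact ⟨_, leavesBelow_leaf i⟩

/-- Cardinality separates the clusters from the leaf sets of the root and of the leaves. This allows
later arguments to treat all vertices uniformly through the range of `leavesBelow`. -/
theorem clusters_eq_diff :
    T.clusters = {B ∈ Set.range T.leavesBelow | 2 ≤ B.ncard ∧ B.ncard < n} := by
  ext B
  constructor
  · intro h
    refine ⟨?_, ncard_of_mem_clusters h⟩
    rw [range_leavesBelow]
    exact Or.inr (Or.inl h)
  · rintro ⟨h, h2, hn⟩
    rw [range_leavesBelow] at h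
    rcases h with rfl | h | ⟨i, rfl⟩
    · rw [Set.ncard_univ, Nat.card_eq_fintype_card, Fintype.card_fin] at hn
      omega
    · exact h
    · simp only [Set.ncard_singleton] at h2
      omega

end LabelledTree
end TreeComplex

/-! ### Contractions as inclusions of cluster families -/

namespace TreeComplex
namespace LabelledTree

open SimpleGraph

variable {n : ℕ} {T T' : LabelledTree n}

/-- A map of trees that collapses connected sets of vertices. -/
structure IsCollapse (f : T.V → T'.V) : Prop where
  surjective : Function.Surjective f
  connected : ∀ u v, f u = f v →
    Relation.ReflTransGen (fun u v => T.graph.Adj u v ∧ f u = f v) u v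
  adj : ∀ u v, T.graph.Adj u v → f u = f v ∨ T'.graph.Adj (f u) (f v)
  root : f T.root = T'.root
  leaf : ∀ i, f (T.leaf i) = T'.leaf i

namespace IsCollapse

variable {f : T.V → T'.V} (hf : IsCollapse f)
include hf

/-- A fibre is connected, so moving inside it from a vertex below `z` to one not below `z` must
cross the edge from `z` to its parent; both ends of that edge are in the fibre. -/
theorem eq_of_separates {x y z : T.V} (h : f x = f y) (hx : T.Below x z) (hy : ¬ T.Below y z) :
    z ≠ T.root ∧ f z = f x ∧ f (T.parent z) = f x := by
  have hc := hf.connected x y h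
  clear h
  induction hc using Relation.ReflTransGen.head_induction_on with
  | refl => exact absurd hx hy
  | @head a c hac _ ih =>
    by_cases hcz : T.Below c z
    · rw [hac.2]
      exact ih hcz
    · rcases adj_iff.1 hac.1 with ⟨ha, hp⟩ | ⟨hc, hp⟩
      · rcases (below_iff_parent ha).1 hx with rfl | h
        · exact ⟨ha, rfl, by rw [hp, hac.2]⟩
        · exact absurd (hp ▸ h) hcz
      · exact absurd (below_trans (hp ▸ below_parent hc) hx) hcz

theorem exists_top_of_ne_root {z : T.V} (hz : f z ≠ T'.root) :
    ∃ w, T.Below z w ∧ f w = f z ∧ w ≠ T.root ∧ f (T.parent w) ≠ f z := by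
  induction z using root_induction with
  | root => exact absurd hf.root hz
  | step z hzr ih =>
    by_cases h : f (T.parent z) = f z
    · obtain ⟨w, h1, h2, h3, h4⟩ := ih (h ▸ hz)
      exact ⟨w, below_trans (below_parent hzr) h1, h2.trans h, h3, h ▸ h4⟩
    · exact ⟨z, below_refl z, rfl, hzr, h⟩

theorem map_parent {u : T.V} (hu : u ≠ T.root) :
    f (T.parent u) = f u ∨ (f u ≠ T'.root ∧ T'.parent (f u) = f (T.parent u)) := by
  -- The induction covers all ancestors of `u`, since the argument for an edge uses the claim at a
  -- vertex higher up. If the image edge pointed the wrong way, the top `x` of the fibre of `parent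
  -- w` would have a parent in the fibre of `w`; this fibre then crosses the edge above `w`, which
  -- is therefore collapsed.
  suffices ∀ u w, T.Below u w → w ≠ T.root →
      f (T.parent w) = f w ∨ (f w ≠ T'.root ∧ T'.parent (f w) = f (T.parent w)) from
    this u u (below_refl u) hu
  clear hu u
  intro u
  induction u using root_induction with
  | root =>
    intro w hw hwr
    exact absurd (root_below_iff.1 hw) hwr
  | step u hu ih =>
    intro w hw hwr
    rcases (below_iff_parent hu).1 hw with rfl | hw
    · by_cases hne : f (T.parent w) = f w
      · exact Or.inl hne
      refine Or.inr ?_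
      rcases adj_iff.1 ((hf.adj _ _ (adj_parent hwr)).resolve_left (Ne.symm hne)) with h | ⟨hr, hp⟩
      · exact h
      · exfalso
        obtain ⟨x, h1, h2, h3, h4⟩ := hf.exists_top_of_ne_root hr
        have h5 := (ih x h1 h3).resolve_left (h2 ▸ h4)
        have h6 : f w = f (T.parent x) := by rw [← h5.2, h2, hp]
        refine hne (hf.eq_of_separates h6 (below_parent hwr) fun hb => ?_).2.1
        have := below_antisymm (below_parent h3) (below_trans hb h1)
        exact (adj_parent h3).ne this
    · exact ih w hw hwr

theorem map_below {u t : T.V} (h : T.Below u t) : T'.Below (f u) (f t) := by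
  revert h
  induction u using root_induction with
  | root =>
    intro h
    rw [root_below_iff.1 h]
    exact below_refl _
  | step u hu ih =>
    intro h
    rcases (below_iff_parent hu).1 h with rfl | h
    · exact below_refl _
    · rcases hf.map_parent hu with h1 | ⟨h1, h2⟩
      · exact h1 ▸ ih h
      · exact below_trans (below_parent h1) (h2 ▸ ih h)

theorem exists_below_of_below {u : T.V} {b : T'.V} (h : T'.Below (f u) b) :
    ∃ t, T.Below u t ∧ f t = b := by
  revert h
  induction u using root_induction with
  | root =>
    intro h
    rw [hf.root, root_below_iff] at h
    exact ⟨_, below_refl _, hf.root.trans h.symm⟩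
  | step u hu ih =>
    intro h
    rcases hf.map_parent hu with h1 | ⟨h1, h2⟩
    · obtain ⟨t, ht, e⟩ := ih (h1 ▸ h)
      exact ⟨t, below_trans (below_parent hu) ht, e⟩
    · rcases (below_iff_parent h1).1 h with e | h3
      · exact ⟨u, below_refl u, e.symm⟩
      · obtain ⟨t, ht, e⟩ := ih (h2 ▸ h3)
        exact ⟨t, below_trans (below_parent hu) ht, e⟩

theorem exists_top (b : T'.V) : ∃ v₀, f v₀ = b ∧ ∀ v, f v = b → T.Below v v₀ := by
  obtain ⟨v₀, hv₀⟩ := Set.Finite.exists_minimalFor T.depth {v | f v = b} (Set.toFinite _)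
    (hf.surjective b)
  refine ⟨v₀, hv₀.1, fun v hv => ?_⟩
  by_contra hc
  have h0 : f v₀ = b := hv₀.1
  obtain ⟨h1, -, h3⟩ := hf.eq_of_separates (h0.trans hv.symm) (below_refl v₀) hc
  have h4 := hv₀.2 (h3.trans h0 : f (T.parent v₀) = b)
    (depth_lt_of_below (below_parent h1) (adj_parent h1).ne).le
  have h5 := depth_lt_of_below (below_parent h1) (adj_parent h1).ne
  omega

/-- The leaves below `b` are those below the topmost vertex of the fibre of `b`. -/
theorem range_leavesBelow_subset : Set.range T'.leavesBelow ⊆ Set.range T.leavesBelow := by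
  rintro _ ⟨b, rfl⟩
  obtain ⟨v₀, h0, hv₀⟩ := hf.exists_top b
  refine ⟨v₀, Set.ext fun i => ⟨fun hi => ?_, fun hi => ?_⟩⟩
  · have := hf.map_below hi
    rwa [hf.leaf, h0] at this
  · obtain ⟨t, ht, e⟩ := hf.exists_below_of_below (u := T.leaf i) (by rw [hf.leaf]; exact hi)
    exact below_trans ht (hv₀ t e)

theorem clusters_subset : T'.clusters ⊆ T.clusters := by
  rw [clusters_eq_diff, clusters_eq_diff]
  exact fun B hB => ⟨hf.range_leavesBelow_subset hB.1, hB.2⟩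

end IsCollapse

theorem IsContraction.clusters_subset (h : T.IsContraction T') : T'.clusters ⊆ T.clusters := by
  obtain ⟨E, hE, f, hs, hker, hadj, hr, hl⟩ := h
  refine IsCollapse.clusters_subset (f := f) ⟨hs, fun u v huv => ?_, fun u v huv => ?_, hr, hl⟩
  · have := (hker u v).1 huv
    rw [reachable_iff_reflTransGen] at this
    refine Relation.ReflTransGen.mono (fun a b hab => ?_) _ _ this
    refine ⟨?_, (hker a b).2 hab.reachable⟩
    exact (mem_edgeSet _).1 (hE ((fromEdgeSet_adj E).1 hab).1).1
  · by_cases h : f u = f v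
    · exact Or.inl h
    · exact Or.inr ((hadj _ _).2 ⟨h, u, v, rfl, rfl, huv⟩)

/-- An isomorphism is a collapse with singleton fibres, in both directions. -/
theorem clusters_eq_of_equiv (h : T ≈ T') : T.clusters = T'.clusters := by
  have key : ∀ {T T' : LabelledTree n}, T ≈ T' → T'.clusters ⊆ T.clusters := by
    rintro T T' ⟨f, hr, hl⟩
    refine IsCollapse.clusters_subset (f := f) ⟨f.surjective, fun u v huv => ?_,
      fun u v huv => Or.inr (f.map_adj_iff.2 huv), hr, hl⟩
    rw [f.injective huv]
  exact Set.Subset.antisymm (key (Setoid.symm h)) (key h)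

/-- The candidates share a leaf and hence form a chain; the deepest one is the image of `v` under
the contraction built below. -/
theorem exists_minimal_above (v : T.V) : ∃ a : T'.V, T.leavesBelow v ⊆ T'.leavesBelow a ∧
      ∀ b, T.leavesBelow v ⊆ T'.leavesBelow b → T'.Below a b := by
  obtain ⟨a, ha⟩ := Set.Finite.exists_maximalFor T'.depth
    {a | T.leavesBelow v ⊆ T'.leavesBelow a} (Set.toFinite _)
    ⟨T'.root, by rw [Set.mem_ofPred_eq, leavesBelow_root]; exact Set.subset_univ _⟩
  refine ⟨a, ha.1, fun b hb => ?_⟩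
  obtain ⟨i, hi⟩ := T.leavesBelow_nonempty v
  rcases below_total (mem_leavesBelow.1 (ha.1 hi)) (mem_leavesBelow.1 (hb hi)) with h | h
  · exact h
  · by_cases hne : b = a
    · exact hne ▸ below_refl b
    · have h1 := depth_lt_of_below h hne
      have h2 := ha.2 hb h1.le
      omega

/-- The map `f` sends `v` to the deepest vertex of `T'` whose leaf set contains that of `v`; its
section `g` picks the vertex of `T` with the same leaf set. The final clause is kept because it
identifies `f` when both families agree. -/
theorem exists_contraction (hsub : Set.range T'.leavesBelow ⊆ Set.range T.leavesBelow) :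
    ∃ E ⊆ T.internalEdges, ∃ f : T.V → T'.V,
      (Function.Surjective f ∧
      (∀ u v, f u = f v ↔ (SimpleGraph.fromEdgeSet E).Reachable u v) ∧
      (∀ a b, T'.graph.Adj a b ↔ a ≠ b ∧ ∃ u v, f u = a ∧ f v = b ∧ T.graph.Adj u v) ∧
      f T.root = T'.root ∧ ∀ i, f (T.leaf i) = T'.leaf i) ∧
      ∀ v b, T.leavesBelow v = T'.leavesBelow b → f v = b := by
  choose f hf hfmin using exists_minimal_above (T := T) (T' := T')
  choose g hg using fun b => hsub ⟨b, rfl⟩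
  have feq : ∀ v b, T.leavesBelow v = T'.leavesBelow b → f v = b := fun v b h =>
    below_antisymm (hfmin v b h.le) (leavesBelow_subset_iff.1 (h ▸ hf v))
  have hfg : ∀ b, f (g b) = b := fun b => feq _ _ (hg b)
  have hmono : ∀ {u v}, T.Below u v → T'.Below (f u) (f v) := fun h =>
    hfmin _ _ ((leavesBelow_mono h).trans (hf _))
  have below_g : ∀ v, T.Below v (g (f v)) := fun v =>
    leavesBelow_subset_iff.1 ((hf v).trans (hg _).ge)
  have hroot : f T.root = T'.root := feq _ _ (by rw [leavesBelow_root, leavesBelow_root])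
  have hleaf : ∀ i, f (T.leaf i) = T'.leaf i := fun i =>
    feq _ _ (by rw [leavesBelow_leaf, leavesBelow_leaf])
  have hgleaf : ∀ i, g (T'.leaf i) = T.leaf i := fun i =>
    leavesBelow_injective (by rw [hg, leavesBelow_leaf, leavesBelow_leaf])
  let E : Set (Sym2 T.V) := {e | e ∈ T.internalEdges ∧ ∃ u v, e = s(u, v) ∧ f u = f v}
  have hker1 : ∀ u v, (fromEdgeSet E).Adj u v → f u = f v := by
    intro u v h
    obtain ⟨-, a, b, hab, e⟩ := ((fromEdgeSet_adj E).1 h).1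
    rcases Sym2.eq_iff.1 hab with ⟨rfl, rfl⟩ | ⟨rfl, rfl⟩
    · exact e
    · exact e.symm
  -- The vertex `g (f v)` is the top of the fibre of `v`. Below it, the parent stays in the fibre
  -- and the edge to it is internal, so one can climb along contracted edges.
  have hclimb : ∀ v, (fromEdgeSet E).Reachable v (g (f v)) := by
    intro v
    induction v using root_induction with
    | root =>
      have : g (f T.root) = T.root := leavesBelow_injective (by
        rw [hg, hroot, leavesBelow_root, leavesBelow_root])
      rw [this]
    | step v hv ih =>
      by_cases h : v = g (f v)
      · rw [← h]
      have hpar := ((below_iff_parent hv).1 (below_g v)).resolve_left (Ne.symm h)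
      have hfp : f (T.parent v) = f v :=
        below_antisymm (by simpa [hfg] using hmono hpar) (hmono (below_parent hv))
      have hnl : ¬ T.IsLeaf v := by
        rintro ⟨i, rfl⟩
        rw [hleaf, hgleaf] at h
        exact h rfl
      have hadj : (fromEdgeSet E).Adj v (T.parent v) := by
        refine (fromEdgeSet_adj E).2 ⟨⟨⟨adj_parent hv, ?_⟩, v, T.parent v, rfl, hfp.symm⟩,
          (adj_parent hv).ne⟩
        intro x hx
        rcases Sym2.mem_iff.1 hx with rfl | rfl
        · exact hnl
        · exact not_isLeaf_parent hv
      exact hadj.reachable.trans (hfp ▸ ih)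
  refine ⟨E, fun e he => he.1, f, ⟨fun b => ⟨_, hfg b⟩, fun u v => ⟨fun h => ?_, fun h => ?_⟩,
    fun a b => ⟨fun h => ?_, ?_⟩, hroot, hleaf⟩, feq⟩
  · exact (hclimb u).trans (h ▸ (hclimb v).symm)
  · obtain ⟨p⟩ := h
    induction p with
    | nil => rfl
    | cons h _ ih => exact (hker1 _ _ h).trans ih
  · refine ⟨h.ne, ?_⟩
    -- The edge above `b` lifts to the edge above `g b`. The image of `parent (g b)` lies between
    -- `b` and `parent b`, and it is not `b` because the parent has strictly more leaves.
    have key : ∀ {b : T'.V}, b ≠ T'.root → g b ≠ T.root ∧ f (T.parent (g b)) = T'.parent b := by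
      intro b hb
      have hgr : g b ≠ T.root := fun e => hb (by rw [← hfg b, e, hroot])
      refine ⟨hgr, ?_⟩
      have h1 : T.Below (g b) (g (T'.parent b)) := leavesBelow_subset_iff.1 (by
        rw [hg, hg]; exact leavesBelow_mono (below_parent hb))
      have h2 : g (T'.parent b) ≠ g b := fun e => (adj_parent hb).ne
        ((hfg b).symm.trans ((congrArg f e).symm.trans (hfg _)))
      have h3 := hmono (((below_iff_parent hgr).1 h1).resolve_left h2)
      rw [hfg] at h3
      have h4 := hmono (below_parent hgr)
      rw [hfg] at h4
      refine below_antisymm h3 (((below_iff_parent hb).1 h4).resolve_left fun e => ?_)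
      have h5 := hf (T.parent (g b))
      rw [e, ← hg b, leavesBelow_subset_iff] at h5
      exact (adj_parent hgr).ne (below_antisymm (below_parent hgr) h5)
    rcases adj_iff.1 h with ⟨ha, hp⟩ | ⟨hb, hp⟩
    · obtain ⟨h1, h2⟩ := key ha
      exact ⟨g a, T.parent (g a), hfg a, h2.trans hp, adj_parent h1⟩
    · obtain ⟨h1, h2⟩ := key hb
      exact ⟨T.parent (g b), g b, h2.trans hp, hfg b, (adj_parent h1).symm⟩
  · have key : ∀ {u : T.V}, u ≠ T.root → f u ≠ f (T.parent u) →
        T'.graph.Adj (f u) (f (T.parent u)) := by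
      intro u hu hne
      have h1 := hmono (below_parent hu)
      have hr : f u ≠ T'.root := by
        intro e
        rw [e] at h1 hne
        exact hne (root_below_iff.1 h1).symm
      have h2 := ((below_iff_parent hr).1 h1).resolve_left hne.symm
      refine adj_iff.2 (Or.inl ⟨hr, below_antisymm h2 ?_⟩)
      have h3 : T.Below u (g (T'.parent (f u))) := leavesBelow_subset_iff.1
        ((hf u).trans ((leavesBelow_mono (below_parent hr)).trans (hg _).ge))
      have h4 := ((below_iff_parent hu).1 h3).resolve_left fun e => (adj_parent hr).ne (by
        conv_lhs => rw [← e, hfg])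
      simpa [hfg] using hmono h4
    rintro ⟨hne, u, v, rfl, rfl, huv⟩
    rcases adj_iff.1 huv with ⟨hu, rfl⟩ | ⟨hv, rfl⟩
    · exact key hu hne
    · exact (key hv hne.symm).symm

theorem range_leavesBelow_subset_iff :
    Set.range T'.leavesBelow ⊆ Set.range T.leavesBelow ↔ T'.clusters ⊆ T.clusters := by
  constructor
  · intro h
    rw [clusters_eq_diff, clusters_eq_diff]
    exact fun B hB => ⟨h hB.1, hB.2⟩
  · intro h
    rw [range_leavesBelow, range_leavesBelow]
    exact Set.insert_subset_insert (Set.union_subset_union_left _ h)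

theorem isContraction_iff : T.IsContraction T' ↔ T'.clusters ⊆ T.clusters := by
  refine ⟨IsContraction.clusters_subset, fun h => ?_⟩
  obtain ⟨E, hE, f, hf, -⟩ := exists_contraction (range_leavesBelow_subset_iff.2 h)
  exact ⟨E, hE, f, hf⟩

/-- With equal families the contraction preserves leaf sets, hence it is injective and collapses
nothing. -/
theorem equiv_iff : T ≈ T' ↔ T.clusters = T'.clusters := by
  refine ⟨clusters_eq_of_equiv, fun h => ?_⟩
  obtain ⟨E, -, f, ⟨hs, -, hadj, hr, hl⟩, feq⟩ :=
    exists_contraction (range_leavesBelow_subset_iff.2 h.ge)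
  have hg : ∀ v, T'.leavesBelow (f v) = T.leavesBelow v := by
    intro v
    obtain ⟨b, hb⟩ := range_leavesBelow_subset_iff.2 h.le ⟨v, rfl⟩
    rw [feq v b hb.symm, hb]
  have hinj : Function.Injective f := fun u v huv =>
    leavesBelow_injective (by rw [← hg u, ← hg v, huv])
  refine ⟨⟨Equiv.ofBijective f ⟨hinj, hs⟩, fun {u v} => ?_⟩, hr, hl⟩
  change T'.graph.Adj (f u) (f v) ↔ _
  rw [hadj]
  constructor
  · rintro ⟨-, u', v', hu, hv, h⟩
    rw [← hinj hu, ← hinj hv]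
    exact h
  · exact fun h => ⟨fun e => h.ne (hinj e), u, v, rfl, rfl, h⟩

/-- Each internal edge joins a unique internal vertex to its parent, and internal vertices are
determined by their leaf sets. -/
theorem ncard_internalEdges : T.internalEdges.ncard = T.clusters.ncard := by
  have h1 : T.internalEdges = (fun v => s(v, T.parent v)) '' {v | T.IsInternal v} := by
    ext e
    constructor
    · induction e using Sym2.ind with
      | _ u v =>
        rintro ⟨he, hl⟩
        rcases adj_iff.1 ((mem_edgeSet _).1 he) with ⟨hu, rfl⟩ | ⟨hv, rfl⟩
        · exact ⟨u, ⟨hl u (Sym2.mem_mk_left _ _), hu⟩, rfl⟩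
        · exact ⟨v, ⟨hl v (Sym2.mem_mk_right _ _), hv⟩, Sym2.eq_swap⟩
    · rintro ⟨v, ⟨hl, hr⟩, rfl⟩
      refine ⟨adj_parent hr, fun x hx => ?_⟩
      rcases Sym2.mem_iff.1 hx with rfl | rfl
      · exact hl
      · exact not_isLeaf_parent hr
  have h2 : T.clusters = T.leavesBelow '' {v | T.IsInternal v} := rfl
  rw [h1, h2, Set.ncard_image_of_injective _ leavesBelow_injective, Set.InjOn.ncard_image]
  intro u hu v hv huv
  rcases Sym2.eq_iff.1 huv with ⟨h, -⟩ | ⟨h, h'⟩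
  · exact h
  · have h3 := below_parent hv.2
    have h4 := below_parent hu.2
    rw [← h] at h3
    rw [h'] at h4
    exact below_antisymm h4 h3

end LabelledTree
end TreeComplex

/-! ### Building a tree from a laminar family -/

namespace TreeComplex

open SimpleGraph

/-- A finite graph whose edges join the vertices to their parents is a tree. -/
theorem isTree_of_parent {V : Type*} [Finite V] {G : SimpleGraph V} {r : V} {par : V → V}
    {d : V → ℕ} (hd : ∀ v, v ≠ r → d (par v) < d v)
    (hadj : ∀ u v, G.Adj u v ↔ (u ≠ r ∧ par u = v) ∨ (v ≠ r ∧ par v = u)) : G.IsTree := by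
  have hreach : ∀ m v, d v = m → G.Reachable v r := by
    intro m
    induction m using Nat.strong_induction_on with
    | _ m ih =>
      rintro v rfl
      by_cases hv : v = r
      · rw [hv]
      · exact Adj.reachable ((hadj _ _).2 (Or.inl ⟨hv, rfl⟩)) |>.trans (ih _ (hd v hv) _ rfl)
  have : Nonempty V := ⟨r⟩
  -- Edges correspond to non-root vertices: an edge cannot be the parent edge of both its ends,
  -- since `d` decreases towards the root.
  rw [isTree_iff_connected_and_card]
  refine ⟨⟨fun u v => (hreach _ u rfl).trans (hreach _ v rfl).symm⟩, ?_⟩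
  have h1 : G.edgeSet = (fun v => s(v, par v)) '' {r}ᶜ := by
    ext e
    constructor
    · induction e using Sym2.ind with
      | _ u v =>
        intro he
        rcases (hadj u v).1 he with ⟨hu, rfl⟩ | ⟨hv, rfl⟩
        · exact ⟨u, hu, rfl⟩
        · exact ⟨v, hv, Sym2.eq_swap⟩
    · rintro ⟨v, hv, rfl⟩
      exact (hadj _ _).2 (Or.inl ⟨hv, rfl⟩)
  have h2 : Set.InjOn (fun v => s(v, par v)) ({r}ᶜ : Set V) := by
    intro u hu v hv huv
    rcases Sym2.eq_iff.1 huv with ⟨h, -⟩ | ⟨h, h'⟩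
    · exact h
    · have h3 := hd u hu
      have h4 := hd v hv
      rw [h'] at h3
      rw [← h] at h4
      omega
  rw [Nat.card_coe_set_eq, h1, h2.ncard_image]
  have h3 := Set.ncard_add_ncard_compl ({r} : Set V)
  rw [Set.ncard_singleton] at h3
  omega

variable {n : ℕ}

/-- The sets of leaves below the vertices of a tree with the given sets of leaves below the
internal vertices. -/
def hierarchy (F : Set (Set (Fin n))) : Set (Set (Fin n)) :=
  insert Set.univ (F ∪ Set.range fun i => {i})

/-- A laminar family of sets of at least two, but not all, elements. -/
def IsTreeFamily (F : Set (Set (Fin n))) : Prop :=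
  Laminar F ∧ ∀ B ∈ F, 2 ≤ B.ncard ∧ B.ncard < n

namespace IsTreeFamily

variable {F : Set (Set (Fin n))} (hF : IsTreeFamily F)

theorem univ_mem_hierarchy : Set.univ ∈ hierarchy F := Or.inl rfl

theorem singleton_mem_hierarchy (i : Fin n) : {i} ∈ hierarchy F := Or.inr (Or.inr ⟨i, rfl⟩)

include hF

theorem laminar_hierarchy : Laminar (hierarchy F) := by
  rintro B (rfl | hB | ⟨i, rfl⟩) C (rfl | hC | ⟨j, rfl⟩)
  · exact Or.inl subset_rfl
  · exact Or.inr (Or.inl (Set.subset_univ _))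
  · exact Or.inr (Or.inl (Set.subset_univ _))
  · exact Or.inl (Set.subset_univ _)
  · exact hF.1 B hB C hC
  · by_cases h : j ∈ B
    · exact Or.inr (Or.inl (Set.singleton_subset_iff.2 h))
    · exact Or.inr (Or.inr (Set.disjoint_singleton_right.2 h))
  · exact Or.inl (Set.subset_univ _)
  · by_cases h : i ∈ C
    · exact Or.inl (Set.singleton_subset_iff.2 h)
    · exact Or.inr (Or.inr (Set.disjoint_singleton_left.2 h))
  · by_cases h : i = j
    · exact Or.inl (by simp [h])
    · exact Or.inr (Or.inr (by simpa using h))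

theorem nonempty_of_mem_hierarchy (hn : 0 < n) {B : Set (Fin n)} (hB : B ∈ hierarchy F) :
    B.Nonempty := by
  rcases hB with rfl | hB | ⟨i, rfl⟩
  · exact ⟨⟨0, hn⟩, trivial⟩
  · have := (hF.2 B hB).1
    exact (Set.ncard_pos (Set.toFinite _)).1 (by omega)
  · exact Set.singleton_nonempty i

/-- The strict supersets of a nonempty `B` meet pairwise, so by laminarity they form a chain; one of
least size is the smallest. -/
theorem exists_parent (hn : 0 < n) (B : hierarchy F) (hB : B.1 ≠ Set.univ) :
    ∃ P : hierarchy F, B.1 ⊂ P.1 ∧ ∀ C : hierarchy F, B.1 ⊂ C.1 → P.1 ⊆ C.1 := by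
  obtain ⟨P, hP⟩ := Set.Finite.exists_minimalFor (fun C : hierarchy F => C.1.ncard)
    {C | B.1 ⊂ C.1} (Set.toFinite _)
    ⟨⟨Set.univ, univ_mem_hierarchy⟩, Set.ssubset_univ_iff.2 hB⟩
  refine ⟨P, hP.1, fun C hC => ?_⟩
  rcases hF.laminar_hierarchy P.1 P.2 C.1 C.2 with h | h | h
  · exact h
  · exact (Set.eq_of_subset_of_ncard_le h (hP.2 hC (Set.ncard_le_ncard h (Set.toFinite _)))
      (Set.toFinite _)).ge
  · obtain ⟨x, hx⟩ := hF.nonempty_of_mem_hierarchy hn B.2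
    have hBP : B.1 ⊂ P.1 := hP.1
    have hBC : B.1 ⊂ C.1 := hC
    exact absurd (hBC.subset hx) (Set.disjoint_left.1 h (hBP.subset hx))

/-- The vertices are the members of the hierarchy, with the full set as root and the singletons as
leaves; the parent of a set is its smallest strict superset. The degree conditions hold because a
set with two elements is never covered by a single proper subset. -/
theorem exists_tree (hn : 2 ≤ n) : ∃ T : LabelledTree n, T.clusters = F := by
  classical
  have hn0 : 0 < n := by omega
  choose! par hpar hparmin using hF.exists_parent hn0
  let r : hierarchy F := ⟨Set.univ, univ_mem_hierarchy⟩
  have hr : ∀ {B : hierarchy F}, B ≠ r → B.1 ≠ Set.univ := fun h e => h (Subtype.ext e)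
  let d : hierarchy F → ℕ := fun B => n - B.1.ncard
  have hle : ∀ B : Set (Fin n), B.ncard ≤ n := fun B =>
    (Set.ncard_le_ncard (Set.subset_univ B) (Set.toFinite _)).trans (by simp [Set.ncard_univ])
  have hd : ∀ B, B ≠ r → d (par B) < d B := by
    intro B hB
    have h1 := Set.ncard_lt_ncard (hpar B (hr hB)) (Set.toFinite _)
    have h2 := hle (par B).1
    change n - _ < n - _
    omega
  let G : SimpleGraph (hierarchy F) :=
    { Adj := fun u v => (u ≠ r ∧ par u = v) ∨ (v ≠ r ∧ par v = u)
      symm := ⟨fun u v h => h.symm⟩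
      loopless := ⟨by
        rintro u (⟨hu, h⟩ | ⟨hu, h⟩)
        · exact (hpar u (hr hu)).ne (congrArg Subtype.val h).symm
        · exact (hpar u (hr hu)).ne (congrArg Subtype.val h).symm⟩ }
  have hG : ∀ u v, G.Adj u v ↔ (u ≠ r ∧ par u = v) ∨ (v ≠ r ∧ par v = u) := fun _ _ => Iff.rfl
  let leaf : Fin n → hierarchy F := fun i => ⟨{i}, singleton_mem_hierarchy i⟩
  let ch : hierarchy F → Set (hierarchy F) := fun B => {C | C ≠ r ∧ par C = B}
  have hnbr : ∀ B, B ≠ r → G.neighborSet B = insert (par B) (ch B) := by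
    intro B hB
    ext C
    rw [mem_neighborSet, hG, Set.mem_insert_iff]
    constructor
    · rintro (h | h)
      · exact Or.inl h.2.symm
      · exact Or.inr h
    · rintro (h | h)
      · exact Or.inl ⟨hB, h.symm⟩
      · exact Or.inr h
  have hnbrcard : ∀ B, B ≠ r → (G.neighborSet B).ncard = (ch B).ncard + 1 := by
    intro B hB
    rw [hnbr B hB, Set.ncard_insert_of_notMem _ (Set.toFinite _)]
    rintro ⟨h, e⟩
    have h1 := hd B hB
    have h2 := hd _ h
    rw [e] at h2
    omega
  have hnbrroot : G.neighborSet r = ch r := by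
    ext C
    rw [mem_neighborSet, hG]
    constructor
    · rintro (h | h)
      · exact absurd rfl h.1
      · exact h
    · exact Or.inr
  have hleafne : ∀ i, leaf i ≠ r := by
    intro i e
    have h1 := congrArg (fun B : hierarchy F => B.1.ncard) e
    simp only [leaf, r, Set.ncard_singleton, Set.ncard_univ, Nat.card_eq_fintype_card,
      Fintype.card_fin] at h1
    omega
  have hchleaf : ∀ i, ch (leaf i) = ∅ := by
    intro i
    rw [Set.eq_empty_iff_forall_notMem]
    rintro C ⟨hC, e⟩
    have h1 := hpar C (hr hC)
    rw [e] at h1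
    have h2 := hF.nonempty_of_mem_hierarchy hn0 C.2
    exact h2.ne_empty (Set.ssubset_singleton_iff.1 h1)
  -- A largest proper subset through `i` is a child: otherwise its parent would be a larger proper
  -- subset of `B` through `i`.
  have hchild : ∀ B : hierarchy F, 2 ≤ B.1.ncard → ∀ i ∈ B.1, ∃ C ∈ ch B, i ∈ C.1 ∧ C.1 ⊂ B.1 := by
    intro B hB i hi
    obtain ⟨C, hC⟩ := Set.Finite.exists_maximalFor (fun C : hierarchy F => C.1.ncard)
      {C | i ∈ C.1 ∧ C.1 ⊂ B.1} (Set.toFinite _) ⟨leaf i, rfl, by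
        refine (Set.singleton_subset_iff.2 hi).ssubset_of_ne fun e => ?_
        rw [← e, Set.ncard_singleton] at hB
        omega⟩
    have hCr : C ≠ r := by
      rintro rfl
      exact (hC.1.2 : Set.univ ⊂ B.1).not_subset (Set.subset_univ _)
    refine ⟨C, ⟨hCr, ?_⟩, hC.1⟩
    have h1 := hparmin C (hr hCr) B hC.1.2
    by_contra hne
    have h2 : (par C).1 ⊂ B.1 := h1.ssubset_of_ne fun e => hne (Subtype.ext e)
    have h3 := Set.ncard_lt_ncard (hpar C (hr hCr)) (Set.toFinite _)
    have h4 := hC.2 (⟨(hpar C (hr hCr)).subset hC.1.1, h2⟩ : i ∈ (par C).1 ∧ (par C).1 ⊂ B.1) h3.le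
    exact absurd h3 (not_lt.2 h4)
  have htwo : ∀ B : hierarchy F, 2 ≤ B.1.ncard → 2 ≤ (ch B).ncard := by
    intro B hB
    obtain ⟨i, hi⟩ := hF.nonempty_of_mem_hierarchy hn0 B.2
    obtain ⟨C, hC, -, hCB⟩ := hchild B hB i hi
    obtain ⟨j, hj, hjC⟩ := Set.exists_of_ssubset hCB
    obtain ⟨D, hD, hjD, -⟩ := hchild B hB j hj
    exact (Set.one_lt_ncard (Set.toFinite _)).2 ⟨C, hC, D, hD, fun e => hjC (e ▸ hjD)⟩
  have hlarge : ∀ B : hierarchy F, B ∉ Set.range leaf → 2 ≤ B.1.ncard := by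
    rintro ⟨B, rfl | hB | ⟨i, rfl⟩⟩ h
    · simpa [Set.ncard_univ] using hn
    · exact (hF.2 B hB).1
    · exact absurd ⟨i, rfl⟩ h
  have hrl : r ∉ Set.range leaf := by
    rintro ⟨i, hi⟩
    exact hleafne i hi
  let T : LabelledTree n :=
    { V := hierarchy F
      finite := inferInstance
      graph := G
      isTree := isTree_of_parent hd hG
      root := r
      leaf := leaf
      leaf_injective := fun i j h => Set.singleton_injective (congrArg Subtype.val h)
      range_leaf := by
        ext B
        constructor
        · rintro ⟨i, rfl⟩
          rw [Set.mem_ofPred_eq, hnbrcard _ (hleafne i), hchleaf, Set.ncard_empty]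
        · intro hB
          by_contra hl
          have h2 := htwo B (hlarge B hl)
          rw [Set.mem_ofPred_eq] at hB
          by_cases hBr : B = r
          · rw [hBr] at hB h2
            rw [hnbrroot] at hB
            omega
          · rw [hnbrcard B hBr] at hB
            omega
      two_le_degree_root := by
        rw [hnbrroot]
        exact htwo r (hlarge r hrl)
      three_le_degree := by
        intro B hB hBr
        rw [hnbrcard B hBr]
        have := htwo B (hlarge B hB)
        omega }
  have hTpar : ∀ B : T.V, B ≠ T.root → T.parent B = par B := fun B hB =>
    LabelledTree.parent_eq_of_decreasing (T := T) (f := par) (d := d)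
      (fun B hB => (hG _ _).2 (Or.inl ⟨hB, rfl⟩)) hd B hB
  have hbelow : ∀ B C : hierarchy F, T.Below B C ↔ B.1 ⊆ C.1 := by
    intro B C
    induction B using LabelledTree.root_induction (T := T) with
    | root =>
      rw [LabelledTree.root_below_iff]
      constructor
      · rintro rfl
        exact subset_rfl
      · intro h
        exact Subtype.ext (Set.univ_subset_iff.1 h)
    | step B hB ih =>
      rw [LabelledTree.below_iff_parent hB, ih, hTpar B hB]
      have h1 := hpar B (hr hB)
      constructor
      · rintro (rfl | h)
        · exact subset_rfl
        · exact h1.subset.trans h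
      · intro h
        by_cases e : C = B
        · exact Or.inl e
        · exact Or.inr (hparmin B (hr hB) C (h.ssubset_of_ne fun e' => e (Subtype.ext e').symm))
  have hlb : ∀ B : hierarchy F, T.leavesBelow B = B.1 := by
    intro B
    ext i
    exact (hbelow (leaf i) B).trans Set.singleton_subset_iff
  refine ⟨T, ?_⟩
  have hrange : Set.range T.leavesBelow = hierarchy F := by
    ext B
    constructor
    · rintro ⟨t, rfl⟩
      rw [hlb]
      exact t.2
    · intro hB
      exact ⟨⟨B, hB⟩, hlb _⟩
  rw [LabelledTree.clusters_eq_diff, hrange]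
  ext B
  constructor
  · rintro ⟨rfl | hB | ⟨i, rfl⟩, h2, h3⟩
    · simp [Set.ncard_univ] at h3
    · exact hB
    · simp at h2
  · intro hB
    exact ⟨Or.inr (Or.inl hB), hF.2 B hB⟩

end IsTreeFamily

theorem LabelledTree.isTreeFamily_clusters (T : LabelledTree n) : IsTreeFamily T.clusters :=
  ⟨laminar_clusters, fun _ => ncard_of_mem_clusters⟩

end TreeComplex

/-! ### Maximal families and trees that are binary except at k-ary preleaves -/

namespace TreeComplex

variable {n k : ℕ}

/-- A laminar family of sets of at least `k`, but not all, elements. -/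
def IsKFamily (k : ℕ) (F : Set (Set (Fin n))) : Prop :=
  Laminar F ∧ ∀ B ∈ F, k ≤ B.ncard ∧ B.ncard < n

theorem IsKFamily.mono {F G : Set (Set (Fin n))} (h : IsKFamily k G) (hFG : F ⊆ G) :
    IsKFamily k F :=
  ⟨h.1.mono hFG, fun B hB => h.2 B (hFG hB)⟩

theorem IsKFamily.isTreeFamily {F : Set (Set (Fin n))} (h : IsKFamily k F) (hk : 2 ≤ k) :
    IsTreeFamily F :=
  ⟨h.1, fun B hB => ⟨hk.trans (h.2 B hB).1, (h.2 B hB).2⟩⟩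

theorem isKFamily_singleton {B : Set (Fin n)} : IsKFamily k {B} ↔ k ≤ B.ncard ∧ B.ncard < n := by
  refine ⟨fun h => h.2 B rfl, fun h => ⟨?_, ?_⟩⟩
  · rintro _ rfl _ rfl
    exact Or.inl subset_rfl
  · rintro _ rfl
    exact h

theorem Laminar.insert {α : Type*} {F : Set (Set α)} (h : Laminar F) {B : Set α}
    (hB : ∀ C ∈ F, B ⊆ C ∨ C ⊆ B ∨ Disjoint B C) : Laminar (insert B F) := by
  rintro C (rfl | hC) D (rfl | hD)
  · exact Or.inl subset_rfl
  · exact hB D hD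
  · rcases hB C hC with h | h | h
    · exact Or.inr (Or.inl h)
    · exact Or.inl h
    · exact Or.inr (Or.inr h.symm)
  · exact h C hC D hD

theorem mem_of_maximal_isKFamily {F : Set (Set (Fin n))} (h : Maximal (IsKFamily k) F)
    {B : Set (Fin n)} (hB : ∀ C ∈ F, B ⊆ C ∨ C ⊆ B ∨ Disjoint B C) (hk : k ≤ B.ncard)
    (hn : B.ncard < n) : B ∈ F := by
  have : IsKFamily k (insert B F) := by
    refine ⟨h.1.1.insert hB, ?_⟩
    rintro C (rfl | hC)
    · exact ⟨hk, hn⟩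
    · exact h.1.2 C hC
  exact h.2 this (Set.subset_insert _ _) (Set.mem_insert _ _)

namespace LabelledTree

variable {T : LabelledTree n}

theorem exists_preleaf_below {v : T.V} (hv : ¬ T.IsLeaf v) : ∃ p, T.IsPreleaf p ∧ T.Below p v := by
  obtain ⟨p, hp⟩ := Set.Finite.exists_maximalFor T.depth {w | T.Below w v ∧ ¬ T.IsLeaf w}
    (Set.toFinite _) ⟨v, below_refl v, hv⟩
  refine ⟨p, ⟨hp.1.2, fun c hc => ?_⟩, hp.1.1⟩
  by_contra hcl
  have h1 := depth_lt_of_below (below_of_mem_children hc) (ne_of_mem_children hc)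
  have h2 := hp.2 (⟨below_trans (below_of_mem_children hc) hp.1.1, hcl⟩ :
    T.Below c v ∧ ¬ T.IsLeaf c) h1.le
  omega

theorem exists_child_of_mem_leavesBelow {v : T.V} (hv : ¬ T.IsLeaf v) {i : Fin n}
    (hi : i ∈ T.leavesBelow v) : ∃ c ∈ T.children v, i ∈ T.leavesBelow c :=
  exists_child_of_below hi fun e => hv (e ▸ isLeaf_leaf i)

theorem IsPreleaf.ncard_leavesBelow {v : T.V} (hv : T.IsPreleaf v) :
    (T.leavesBelow v).ncard = T.outdegree v := by
  have : T.children v = T.leaf '' T.leavesBelow v := by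
    ext c
    constructor
    · intro hc
      obtain ⟨i, rfl⟩ := hv.2 c hc
      exact ⟨i, below_of_mem_children hc, rfl⟩
    · rintro ⟨i, hi, rfl⟩
      obtain ⟨c, hc, hic⟩ := exists_child_of_mem_leavesBelow hv.1 hi
      rwa [(hv.2 c hc).below_iff.1 hic]
  rw [outdegree, this, Set.ncard_image_of_injective _ T.leaf_injective]

theorem disjoint_leavesBelow_of_children {v a b : T.V} (ha : a ∈ T.children v)
    (hb : b ∈ T.children v) (hab : a ≠ b) : Disjoint (T.leavesBelow a) (T.leavesBelow b) :=
  Set.disjoint_left.2 fun _ hi hj => hab (children_eq_of_below ha hb hi hj)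

/-- Below every internal vertex there is a preleaf, which already has k leaves. -/
theorem IsKEqualBinary.isKFamily (h : T.IsKEqualBinary k) : IsKFamily k T.clusters := by
  refine ⟨laminar_clusters, ?_⟩
  rintro B hB
  refine ⟨?_, (ncard_of_mem_clusters hB).2⟩
  obtain ⟨t, ht, rfl⟩ := hB
  obtain ⟨p, hp, hpt⟩ := exists_preleaf_below ht.1
  rw [← (h p hp.1).1 hp, ← hp.ncard_leavesBelow]
  exact Set.ncard_le_ncard (leavesBelow_mono hpt) (Set.toFinite _)

/-- Let `B` be compatible with all clusters and `t` the deepest vertex whose leaf set contains `B`.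
Each child of `t` that meets `B` has its leaf set inside `B`. At a preleaf, size k forces equality;
at a binary vertex, `B` must meet both children. -/
theorem IsKEqualBinary.maximal (hk : 2 ≤ k) (h : T.IsKEqualBinary k) :
    Maximal (IsKFamily k) T.clusters := by
  refine ⟨h.isKFamily, fun G hG hTG B hB => ?_⟩
  obtain ⟨hBk, hBn⟩ := hG.2 B hB
  obtain ⟨t, ht⟩ := Set.Finite.exists_maximalFor T.depth {t | B ⊆ T.leavesBelow t}
    (Set.toFinite _) ⟨T.root, by rw [Set.mem_ofPred_eq, leavesBelow_root]; exact Set.subset_univ _⟩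
  have hBt : B ⊆ T.leavesBelow t := ht.1
  have htl : ¬ T.IsLeaf t := by
    rintro ⟨i, rfl⟩
    rw [leavesBelow_leaf] at hBt
    have := Set.ncard_le_ncard hBt (Set.toFinite _)
    rw [Set.ncard_singleton] at this
    omega
  have hnot : ∀ c ∈ T.children t, ¬ B ⊆ T.leavesBelow c := by
    intro c hc hBc
    have h1 := depth_lt_of_below (below_of_mem_children hc) (ne_of_mem_children hc)
    have h2 := ht.2 hBc h1.le
    omega
  have hcomp : ∀ c ∈ T.children t, ¬ Disjoint (T.leavesBelow c) B → T.leavesBelow c ⊆ B := by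
    intro c hc hd
    by_cases hcl : T.IsLeaf c
    · obtain ⟨i, rfl⟩ := hcl
      rw [leavesBelow_leaf] at hd ⊢
      rw [Set.disjoint_singleton_left, not_not] at hd
      exact Set.singleton_subset_iff.2 hd
    · have hci : T.IsInternal c := ⟨hcl, (mem_children.1 hc).1⟩
      rcases hG.1 _ (hTG ⟨c, hci, rfl⟩) B hB with h1 | h1 | h1
      · exact h1
      · exact absurd h1 (hnot c hc)
      · exact absurd h1 hd
  have heq : T.leavesBelow t = B := by
    by_cases hp : T.IsPreleaf t
    · refine (Set.eq_of_subset_of_ncard_le hBt ?_ (Set.toFinite _)).symm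
      rw [hp.ncard_leavesBelow, (h t htl).1 hp]
      exact hBk
    · obtain ⟨a, b, hab, hch⟩ := Set.ncard_eq_two.1 ((h t htl).2 hp)
      -- If `B` missed the leaves below `a`, it would lie below `b` alone, against the choice of
      -- `t`.
      have key : ∀ {a b : T.V}, T.children t = {a, b} → T.leavesBelow a ⊆ B := by
        intro a b hch
        refine hcomp a (by rw [hch]; simp) fun hd => hnot b (by rw [hch]; simp) fun i hi => ?_
        obtain ⟨c, hc, hic⟩ := exists_child_of_mem_leavesBelow htl (hBt hi)
        rw [hch] at hc
        rcases hc with rfl | rfl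
        · exact absurd hi (Set.disjoint_left.1 hd hic)
        · exact hic
      refine Set.Subset.antisymm (fun i hi => ?_) hBt
      obtain ⟨c, hc, hic⟩ := exists_child_of_mem_leavesBelow htl hi
      have hch' : T.children t = {b, a} := by rw [hch, Set.pair_comm]
      rw [hch] at hc
      rcases hc with rfl | rfl
      · exact key hch hic
      · exact key hch' hic
  refine ⟨t, ⟨htl, ?_⟩, heq⟩
  rintro rfl
  rw [← heq, leavesBelow_root, Set.ncard_univ, Nat.card_eq_fintype_card, Fintype.card_fin] at hBn
  omega

/-- No cluster lies strictly inside the leaf set of a preleaf, so if it had more than k leaves, any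
k of them could be added as a new cluster. -/
theorem outdegree_eq_of_isPreleaf_of_maximal (hkn : k < n)
    (h : Maximal (IsKFamily k) T.clusters) {v : T.V} (hv : T.IsPreleaf v)
    (hvk : k ≤ (T.leavesBelow v).ncard) : T.outdegree v = k := by
  rw [← hv.ncard_leavesBelow]
  refine le_antisymm ?_ hvk
  by_contra hlt
  obtain ⟨B, hBv, hBk⟩ := Set.exists_subset_card_eq hvk
  have key : ∀ t, T.IsInternal t → T.leavesBelow t ⊆ T.leavesBelow v → t = v := by
    intro t ht htv
    by_contra hne
    obtain ⟨c, hc, htc⟩ := exists_child_of_below (leavesBelow_subset_iff.1 htv) hne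
    have hcl := hv.2 c hc
    exact ht.1 (hcl.below_iff.1 htc ▸ hcl)
  have hB : B ∈ T.clusters := by
    refine mem_of_maximal_isKFamily h ?_ hBk.ge (by omega)
    rintro _ ⟨t, ht, rfl⟩
    rcases T.leavesBelow_comparable t v with h1 | h1 | h1
    · rw [key t ht h1]
      exact Or.inl hBv
    · exact Or.inl (hBv.trans h1)
    · exact Or.inr (Or.inr (h1.symm.mono_left hBv))
  obtain ⟨t, ht, rfl⟩ := hB
  rw [key t ht hBv] at hBk
  omega

/-- With three or more children, one of them not a leaf, two children could be merged into a new
cluster. -/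
theorem outdegree_eq_two_of_maximal (h : Maximal (IsKFamily k) T.clusters)
    {v : T.V} (hv : ¬ T.IsLeaf v) (hp : ¬ T.IsPreleaf v) : T.outdegree v = 2 := by
  obtain ⟨w, hw, hwl⟩ : ∃ w ∈ T.children v, ¬ T.IsLeaf w := by
    by_contra hc
    push Not at hc
    exact hp ⟨hv, hc⟩
  refine le_antisymm ?_ (two_le_outdegree hv)
  by_contra hlt
  have h3 : 2 < (T.children v).ncard := not_le.1 hlt
  obtain ⟨w', hw', hne'⟩ := Set.exists_ne_of_one_lt_ncard (by omega : 1 < (T.children v).ncard) w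
  obtain ⟨w'', hw'', hne''⟩ : ∃ x ∈ T.children v, x ∉ ({w, w'} : Set T.V) := by
    by_contra hc
    push Not at hc
    have := Set.ncard_le_ncard hc (Set.toFinite _)
    rw [Set.ncard_pair hne'.symm] at this
    omega
  simp only [Set.mem_insert_iff, Set.mem_singleton_iff, not_or] at hne''
  obtain ⟨j, hj⟩ := T.leavesBelow_nonempty w''
  -- The child `w` is internal, which makes `B` have at least k elements; the third child `w''`
  -- keeps `B` a proper subset of the leaves below `v`.
  set B := T.leavesBelow w ∪ T.leavesBelow w' with hBdef
  have hjB : j ∉ B := by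
    rintro (hjw | hjw)
    · exact hne''.1 (children_eq_of_below hw'' hw hj hjw)
    · exact hne''.2 (children_eq_of_below hw'' hw' hj hjw)
  have hBv : B ⊆ T.leavesBelow v := Set.union_subset (leavesBelow_mono (below_of_mem_children hw))
    (leavesBelow_mono (below_of_mem_children hw'))
  have hwi : T.IsInternal w := ⟨hwl, (mem_children.1 hw).1⟩
  have hB : B ∈ T.clusters := by
    refine mem_of_maximal_isKFamily h ?_ ?_ (ncard_lt_of_ne_univ fun e => hjB (e ▸ trivial))
    · rintro _ ⟨t, ht, rfl⟩
      rcases T.leavesBelow_comparable t v with h1 | h1 | h1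
      · by_cases htv : t = v
        · exact Or.inl (htv ▸ hBv)
        · obtain ⟨c, hc, htc⟩ := exists_child_of_below (leavesBelow_subset_iff.1 h1) htv
          have htc' := leavesBelow_mono htc
          by_cases hcw : c = w
          · exact Or.inr (Or.inl (Set.subset_union_of_subset_left (hcw ▸ htc') _))
          by_cases hcw' : c = w'
          · exact Or.inr (Or.inl (Set.subset_union_of_subset_right (hcw' ▸ htc') _))
          · refine Or.inr (Or.inr (Set.disjoint_union_left.2 ⟨?_, ?_⟩))
            · exact (disjoint_leavesBelow_of_children hw hc (Ne.symm hcw)).mono_right htc'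
            · exact (disjoint_leavesBelow_of_children hw' hc (Ne.symm hcw')).mono_right htc'
      · exact Or.inl (hBv.trans h1)
      · exact Or.inr (Or.inr (h1.symm.mono_left hBv))
    · exact ((h.1.2 _ ⟨w, hwi, rfl⟩).1).trans
        (Set.ncard_le_ncard Set.subset_union_left (Set.toFinite _))
  -- A vertex with leaf set `B` would be strictly below `v`, hence below one child of `v`, and that
  -- child would have to be both `w` and `w'`.
  obtain ⟨t, ht, htB⟩ := hB
  have htv : T.Below t v := leavesBelow_subset_iff.1 (htB ▸ hBv)
  have hne : t ≠ v := by
    rintro rfl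
    exact hjB (htB ▸ leavesBelow_mono (below_of_mem_children hw'') hj)
  obtain ⟨c, hc, htc⟩ := exists_child_of_below htv hne
  have h1 : T.Below w t := leavesBelow_subset_iff.1 (htB ▸ Set.subset_union_left)
  have h2 : T.Below w' t := leavesBelow_subset_iff.1 (htB ▸ Set.subset_union_right)
  have h3 := children_eq_of_below hw hc (below_refl w) (below_trans h1 htc)
  have h4 := children_eq_of_below hw' hc (below_refl w') (below_trans h2 htc)
  exact hne' (h4.trans h3.symm)

theorem isKEqualBinary_iff (hk : 2 ≤ k) (hkn : k < n) :
    T.IsKEqualBinary k ↔ Maximal (IsKFamily k) T.clusters := by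
  refine ⟨fun h => h.maximal hk, fun h v hv => ⟨fun hp => ?_, fun hp => ?_⟩⟩
  · refine outdegree_eq_of_isPreleaf_of_maximal hkn h hp ?_
    by_cases hr : v = T.root
    · subst hr
      rw [leavesBelow_root, Set.ncard_univ, Nat.card_eq_fintype_card, Fintype.card_fin]
      exact hkn.le
    · exact (h.1.2 _ ⟨v, ⟨hv, hr⟩, rfl⟩).1
  · exact outdegree_eq_two_of_maximal h hv hp

end LabelledTree

end TreeComplex

/-! ### Tree types, their simplices and the isomorphism of complexes -/

namespace TreeComplex

variable {n k : ℕ}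

namespace TreeType

/-- The family of the sets of leaves below the internal vertices of trees of the given type. -/
def fam (τ : TreeType n) : Set (Set (Fin n)) :=
  Quotient.lift LabelledTree.clusters (fun _ _ h => LabelledTree.clusters_eq_of_equiv h) τ

theorem fam_type (T : LabelledTree n) : T.type.fam = T.clusters := rfl

theorem exists_type_eq (τ : TreeType n) : ∃ T : LabelledTree n, T.type = τ := Quotient.exists_rep τ

theorem fam_injective : Function.Injective (fam (n := n)) := by
  intro σ τ h
  obtain ⟨S, rfl⟩ := exists_type_eq σ
  obtain ⟨T, rfl⟩ := exists_type_eq τ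
  exact Quotient.sound (LabelledTree.equiv_iff.2 h)

theorem isTreeFamily_fam (τ : TreeType n) : IsTreeFamily τ.fam := by
  obtain ⟨T, rfl⟩ := exists_type_eq τ
  exact T.isTreeFamily_clusters

theorem exists_fam_eq (hn : 2 ≤ n) {F : Set (Set (Fin n))} (hF : IsTreeFamily F) :
    ∃ τ : TreeType n, τ.fam = F := by
  obtain ⟨T, hT⟩ := hF.exists_tree hn
  exact ⟨T.type, hT⟩

instance : Finite (TreeType n) := Finite.of_injective fam fam_injective

theorem isContraction_iff {σ τ : TreeType n} : τ.IsContraction σ ↔ σ.fam ⊆ τ.fam := by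
  constructor
  · rintro ⟨T, S, rfl, rfl, h⟩
    exact LabelledTree.isContraction_iff.1 h
  · intro h
    obtain ⟨S, rfl⟩ := exists_type_eq σ
    obtain ⟨T, rfl⟩ := exists_type_eq τ
    exact ⟨T, S, rfl, rfl, LabelledTree.isContraction_iff.2 h⟩

theorem hasOneInternalEdge_iff {ν : TreeType n} : ν.HasOneInternalEdge ↔ ∃ B, ν.fam = {B} := by
  constructor
  · rintro ⟨T, rfl, h⟩
    rw [LabelledTree.ncard_internalEdges] at h
    exact Set.ncard_eq_one.1 h
  · rintro ⟨B, h⟩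
    obtain ⟨T, rfl⟩ := exists_type_eq ν
    exact ⟨T, rfl, by rw [LabelledTree.ncard_internalEdges, ← fam_type, h, Set.ncard_singleton]⟩

theorem mem_vertexSet {τ ν : TreeType n} : ν ∈ τ.vertexSet ↔ ∃ B ∈ τ.fam, ν.fam = {B} := by
  constructor
  · rintro ⟨h1, h2⟩
    obtain ⟨B, hB⟩ := hasOneInternalEdge_iff.1 h1
    rw [isContraction_iff, hB, Set.singleton_subset_iff] at h2
    exact ⟨B, h2, hB⟩
  · rintro ⟨B, hB, h⟩
    exact ⟨hasOneInternalEdge_iff.2 ⟨B, h⟩,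
      isContraction_iff.2 (by rw [h, Set.singleton_subset_iff]; exact hB)⟩

theorem exists_fam_eq_singleton (hn : 2 ≤ n) (τ : TreeType n) {B : Set (Fin n)} (hB : B ∈ τ.fam) :
    ∃ ν : TreeType n, ν.fam = {B} := by
  refine exists_fam_eq hn ⟨τ.isTreeFamily_fam.1.mono (Set.singleton_subset_iff.2 hB), ?_⟩
  rintro _ rfl
  exact τ.isTreeFamily_fam.2 _ hB

/-- Each cluster alone is again the family of a tree, so it is visible as a vertex. -/
theorem vertexSet_subset_iff (hn : 2 ≤ n) {σ τ : TreeType n} :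
    σ.vertexSet ⊆ τ.vertexSet ↔ σ.fam ⊆ τ.fam := by
  constructor
  · intro h B hB
    obtain ⟨ν, hν⟩ := exists_fam_eq_singleton hn σ hB
    obtain ⟨C, hC, hν'⟩ := mem_vertexSet.1 (h (mem_vertexSet.2 ⟨B, hB, hν⟩))
    rw [Set.singleton_injective (hν.symm.trans hν')]
    exact hC
  · intro h ν hν
    obtain ⟨B, hB, hν⟩ := mem_vertexSet.1 hν
    exact mem_vertexSet.2 ⟨B, h hB, hν⟩

theorem mem_maximalTreeTypes (hk : 2 ≤ k) (hkn : k < n) {μ : TreeType n} :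
    μ ∈ maximalTreeTypes n k ↔ Maximal (IsKFamily k) μ.fam := by
  constructor
  · rintro ⟨T, rfl, h⟩
    exact (LabelledTree.isKEqualBinary_iff hk hkn).1 h
  · intro h
    obtain ⟨T, rfl⟩ := exists_type_eq μ
    exact ⟨T, rfl, (LabelledTree.isKEqualBinary_iff hk hkn).2 h⟩

theorem exists_maximal_of_isKFamily (hk : 2 ≤ k) (hkn : k < n) {F : Set (Set (Fin n))}
    (hF : IsKFamily k F) : ∃ μ ∈ maximalTreeTypes n k, F ⊆ μ.fam := by
  obtain ⟨M, hFM, hM⟩ := (Set.toFinite {F : Set (Set (Fin n)) | IsKFamily k F}).exists_le_maximal hF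
  obtain ⟨μ, rfl⟩ := exists_fam_eq (by omega) (hM.1.isTreeFamily hk)
  exact ⟨μ, (mem_maximalTreeTypes hk hkn).2 hM, hFM⟩

theorem mem_kEqualTreeTypes (hk : 2 ≤ k) (hkn : k < n) {τ : TreeType n} :
    τ ∈ kEqualTreeTypes n k ↔ IsKFamily k τ.fam := by
  constructor
  · rintro ⟨μ, hμ, h⟩
    exact ((mem_maximalTreeTypes hk hkn).1 hμ).1.mono (isContraction_iff.1 h)
  · intro h
    obtain ⟨μ, hμ, hle⟩ := exists_maximal_of_isKFamily hk hkn h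
    exact ⟨μ, hμ, isContraction_iff.2 hle⟩

/-- The family given by a set of types with one internal edge. -/
def jointFam (s : Set (TreeType n)) : Set (Set (Fin n)) := {B | ∃ ν ∈ s, ν.fam = {B}}

theorem subset_vertexSet_iff {s : Set (TreeType n)} {τ : TreeType n} :
    s ⊆ τ.vertexSet ↔ (∀ ν ∈ s, ν.HasOneInternalEdge) ∧ jointFam s ⊆ τ.fam := by
  constructor
  · refine fun h => ⟨fun ν hν => (h hν).1, ?_⟩
    rintro B ⟨ν, hν, e⟩
    obtain ⟨C, hC, e'⟩ := mem_vertexSet.1 (h hν)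
    rw [Set.singleton_injective (e.symm.trans e')]
    exact hC
  · rintro ⟨h1, h2⟩ ν hν
    obtain ⟨B, hB⟩ := hasOneInternalEdge_iff.1 (h1 ν hν)
    exact mem_vertexSet.2 ⟨B, h2 ⟨ν, hν, hB⟩, hB⟩

theorem eq_vertexSet {s : Set (TreeType n)} {τ : TreeType n}
    (h : ∀ ν ∈ s, ν.HasOneInternalEdge) (hτ : τ.fam = jointFam s) : s = τ.vertexSet := by
  refine Set.Subset.antisymm (subset_vertexSet_iff.2 ⟨h, hτ.ge⟩) fun ν hν => ?_
  obtain ⟨B, hB, e⟩ := mem_vertexSet.1 hν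
  rw [hτ] at hB
  obtain ⟨ν', hν', e'⟩ := hB
  rwa [fam_injective (e.trans e'.symm)]

end TreeType

open TreeType

/-- Every laminar family of sets of admissible size extends to a maximal one, so being generated by
the maximal types adds no further condition. -/
theorem mem_faces_iff (hk : 2 ≤ k) (hkn : k < n) {s : Finset (TreeType n)} :
    s ∈ (kEqualTreeComplex n k).faces ↔ s.Nonempty ∧
      (∀ ν ∈ s, ν.HasOneInternalEdge) ∧ IsKFamily k (jointFam (s : Set (TreeType n))) := by
  constructor
  · rintro ⟨hne, μ, hμ, hs⟩
    obtain ⟨h1, h2⟩ := subset_vertexSet_iff.1 hs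
    exact ⟨hne, h1, ((mem_maximalTreeTypes hk hkn).1 hμ).1.mono h2⟩
  · rintro ⟨hne, h1, h2⟩
    obtain ⟨μ, hμ, hle⟩ := exists_maximal_of_isKFamily hk hkn h2
    exact ⟨hne, μ, hμ, subset_vertexSet_iff.2 ⟨h1, hle⟩⟩

theorem mem_vertices_iff (hk : 2 ≤ k) (hkn : k < n) {ν : TreeType n} :
    ν ∈ vertices (kEqualTreeComplex n k) ↔ ∃ B, ν.fam = {B} ∧ k ≤ B.ncard ∧ B.ncard < n := by
  have key : ∀ B, ν.fam = {B} → jointFam (({ν} : Finset (TreeType n)) : Set (TreeType n)) = {B} := by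
    intro B hB
    ext C
    simp only [jointFam, Finset.coe_singleton, Set.mem_singleton_iff, exists_eq_left,
      Set.mem_ofPred_eq, hB]
    exact ⟨fun h => (Set.singleton_injective h).symm, fun h => h ▸ rfl⟩
  change {ν} ∈ (kEqualTreeComplex n k).faces ↔ _
  rw [mem_faces_iff hk hkn]
  constructor
  · rintro ⟨-, h1, h2⟩
    obtain ⟨B, hB⟩ := hasOneInternalEdge_iff.1 (h1 ν (by simp))
    rw [key B hB, isKFamily_singleton] at h2
    exact ⟨B, hB, h2⟩
  · rintro ⟨B, hB, h⟩
    refine ⟨Finset.singleton_nonempty _, ?_, ?_⟩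
    · intro ν' hν'
      rw [Finset.mem_singleton.1 hν']
      exact hasOneInternalEdge_iff.2 ⟨B, hB⟩
    · rw [key B hB, isKFamily_singleton]
      exact h

theorem maximal_face_iff (hk : 2 ≤ k) (hkn : k < n) (s : Finset (TreeType n)) :
    Maximal (· ∈ (kEqualTreeComplex n k).faces) s ↔
      ∃ μ ∈ maximalTreeTypes n k, (s : Set (TreeType n)) = μ.vertexSet := by
  constructor
  · rintro ⟨⟨hne, μ, hμ, hs⟩, hmax⟩
    refine ⟨μ, hμ, Set.Subset.antisymm hs ?_⟩
    have h1 : ((Set.toFinite μ.vertexSet).toFinset : Set (TreeType n)) = μ.vertexSet := by simp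
    have h2 : s ⊆ (Set.toFinite μ.vertexSet).toFinset := by
      rwa [← Finset.coe_subset, h1]
    have h3 := hmax ⟨hne.mono h2, μ, hμ, h1.le⟩ h2
    rw [← h1]
    exact Finset.coe_subset.2 h3
  · rintro ⟨μ, hμ, hs⟩
    have hM := (mem_maximalTreeTypes hk hkn).1 hμ
    have hne : s.Nonempty := by
      -- The empty family is not maximal, since any k-set can be added to it; this uses k < n.
      have h1 : μ.fam.Nonempty := by
        by_contra hc
        rw [Set.not_nonempty_iff_eq_empty] at hc
        obtain ⟨B, -, hB⟩ := Set.exists_subset_card_eq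
          (show k ≤ (Set.univ : Set (Fin n)).ncard by simpa [Set.ncard_univ] using hkn.le)
        have := mem_of_maximal_isKFamily hM (B := B) (by simp [hc]) hB.ge (by omega)
        rw [hc] at this
        exact this
      obtain ⟨B, hB⟩ := h1
      obtain ⟨ν, hν⟩ := exists_fam_eq_singleton (by omega) μ hB
      have : ν ∈ (s : Set (TreeType n)) := hs ▸ mem_vertexSet.2 ⟨B, hB, hν⟩
      exact ⟨ν, this⟩
    refine ⟨⟨hne, μ, hμ, hs.le⟩, ?_⟩
    rintro t ⟨-, μ', hμ', ht⟩ hst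
    have h1 : μ.vertexSet ⊆ μ'.vertexSet := hs ▸ (Finset.coe_subset.2 hst).trans ht
    have h2 := hM.2 ((mem_maximalTreeTypes hk hkn).1 hμ').1
      ((vertexSet_subset_iff (by omega)).1 h1)
    have h3 := (vertexSet_subset_iff (by omega)).2 h2
    exact Finset.coe_subset.1 ((ht.trans h3).trans hs.ge)

/-- The set of leaves below the internal vertex of a vertex of the complex of `k`-equal trees. -/
noncomputable def vertexBlock (hk : 2 ≤ k) (hkn : k < n)
    (ν : vertices (kEqualTreeComplex n k)) : Set (Fin n) :=
  ((mem_vertices_iff hk hkn).1 ν.2).choose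

theorem fam_eq_vertexBlock (hk : 2 ≤ k) (hkn : k < n) (ν : vertices (kEqualTreeComplex n k)) :
    ν.1.fam = {vertexBlock hk hkn ν} :=
  ((mem_vertices_iff hk hkn).1 ν.2).choose_spec.1

theorem ncard_vertexBlock (hk : 2 ≤ k) (hkn : k < n) (ν : vertices (kEqualTreeComplex n k)) :
    k ≤ (vertexBlock hk hkn ν).ncard ∧ (vertexBlock hk hkn ν).ncard < n :=
  ((mem_vertices_iff hk hkn).1 ν.2).choose_spec.2

open KEqualLattice

theorem block_ne_top (hk : 2 ≤ k) (hkn : k ≤ n) {B : Set (Fin n)} (hB : k ≤ B.ncard) :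
    block hk B hB ≠ ⊤ ↔ B.ncard < n := by
  rw [top_eq_block hk hkn]
  constructor
  · intro h
    refine LabelledTree.ncard_lt_of_ne_univ fun e => h ?_
    subst e
    rfl
  · intro h e
    have := block_injective hk e
    subst this
    simp [Set.ncard_univ] at h

theorem mem_vertices_reducedNestedSetComplex (hk : 2 ≤ k) (hkn : k ≤ n) {X : KEqualLattice n k} :
    X ∈ vertices (reducedNestedSetComplex (irreducibles (KEqualLattice n k))) ↔
      ∃ B, ∃ hB : k ≤ B.ncard, B.ncard < n ∧ X = block hk B hB := by
  constructor
  · rintro ⟨-, h1, h2⟩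
    obtain ⟨B, hB, rfl⟩ := (mem_irreducibles_iff hk).1 (h1.1 (Finset.mem_coe.2 (Finset.mem_singleton_self X)))
    exact ⟨B, hB, (block_ne_top hk hkn hB).1 fun e => h2 (by simp [e]), rfl⟩
  · rintro ⟨B, hB, hBn, rfl⟩
    refine ⟨Finset.singleton_nonempty _, ⟨?_, ?_⟩, ?_⟩
    · intro X hX
      rw [Finset.mem_coe, Finset.mem_singleton] at hX
      exact hX ▸ block_mem_irreducibles hk hB
    · intro A hA h2
      have := (Finset.card_le_card hA).trans_eq (Finset.card_singleton _)
      omega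
    · rw [Finset.mem_singleton]
      exact ((block_ne_top hk hkn hB).2 hBn).symm

/-- The bijection between the vertices of the complex of `k`-equal trees and the vertices of the
reduced minimal nested set complex of the `k`-equal lattice. -/
noncomputable def vertexEquiv (hk : 2 ≤ k) (hkn : k < n) :
    vertices (kEqualTreeComplex n k) ≃
      vertices (reducedNestedSetComplex (irreducibles (KEqualLattice n k))) :=
  Equiv.ofBijective
    (fun ν => ⟨block hk (vertexBlock hk hkn ν) (ncard_vertexBlock hk hkn ν).1,
      (mem_vertices_reducedNestedSetComplex hk hkn.le).2
        ⟨_, (ncard_vertexBlock hk hkn ν).1, (ncard_vertexBlock hk hkn ν).2, rfl⟩⟩) <| by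
    constructor
    · intro ν ν' h
      have := block_injective hk (hB := (ncard_vertexBlock hk hkn ν).1)
        (hC := (ncard_vertexBlock hk hkn ν').1) (congrArg Subtype.val h)
      exact Subtype.ext (fam_injective (by
        rw [fam_eq_vertexBlock hk hkn, fam_eq_vertexBlock hk hkn, this]))
    · rintro ⟨X, hX⟩
      obtain ⟨B, hB, hBn, rfl⟩ := (mem_vertices_reducedNestedSetComplex hk hkn.le).1 hX
      obtain ⟨ν, hν⟩ := exists_fam_eq (by omega)
        ((isKFamily_singleton.2 ⟨hB, hBn⟩).isTreeFamily hk)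
      let v : vertices (kEqualTreeComplex n k) := ⟨ν, (mem_vertices_iff hk hkn).2 ⟨B, hν, hB, hBn⟩⟩
      have : vertexBlock hk hkn v = B :=
        Set.singleton_injective ((fam_eq_vertexBlock hk hkn v).symm.trans hν)
      have key : ∀ C (hC : k ≤ C.ncard), C = B → block hk C hC = block hk B hB := by
        rintro _ _ rfl
        rfl
      exact ⟨v, Subtype.ext (key _ (ncard_vertexBlock hk hkn v).1 this)⟩

theorem jointFam_map (hk : 2 ≤ k) (hkn : k < n) (s : Finset (vertices (kEqualTreeComplex n k))) :
    jointFam ((s.map (Function.Embedding.subtype _) : Finset (TreeType n)) : Set (TreeType n)) =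
      {B | ∃ ν ∈ s, vertexBlock hk hkn ν = B} := by
  ext B
  constructor
  · rintro ⟨ν, hν, hB⟩
    obtain ⟨v, hv, rfl⟩ := Finset.mem_map.1 (Finset.mem_coe.1 hν)
    exact ⟨v, hv, Set.singleton_injective ((fam_eq_vertexBlock hk hkn v).symm.trans hB)⟩
  · rintro ⟨v, hv, rfl⟩
    exact ⟨v.1, Finset.mem_coe.2 (Finset.mem_map.2 ⟨v, hv, rfl⟩), fam_eq_vertexBlock hk hkn v⟩

theorem mem_map_vertexEquiv (hk : 2 ≤ k) (hkn : k < n)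
    {s : Finset (vertices (kEqualTreeComplex n k))} {X : KEqualLattice n k} :
    X ∈ (s.map (vertexEquiv hk hkn).toEmbedding).map (Function.Embedding.subtype _) ↔
      ∃ ν ∈ s, X = block hk (vertexBlock hk hkn ν) (ncard_vertexBlock hk hkn ν).1 := by
  constructor
  · intro h
    obtain ⟨w, hw, rfl⟩ := Finset.mem_map.1 h
    obtain ⟨v, hv, rfl⟩ := Finset.mem_map.1 hw
    exact ⟨v, hv, rfl⟩
  · rintro ⟨v, hv, rfl⟩
    exact Finset.mem_map.2 ⟨_, Finset.mem_map.2 ⟨v, hv, rfl⟩, rfl⟩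

theorem blocks_map (hk : 2 ≤ k) (hkn : k < n) (s : Finset (vertices (kEqualTreeComplex n k))) :
    blocks hk ((s.map (vertexEquiv hk hkn).toEmbedding).map (Function.Embedding.subtype _)) =
      {B | ∃ ν ∈ s, vertexBlock hk hkn ν = B} := by
  ext B
  constructor
  · rintro ⟨hB, h⟩
    obtain ⟨v, hv, e⟩ := (mem_map_vertexEquiv hk hkn).1 h
    exact ⟨v, hv, (block_injective hk e).symm⟩
  · rintro ⟨v, hv, rfl⟩
    exact ⟨(ncard_vertexBlock hk hkn v).1, (mem_map_vertexEquiv hk hkn).2 ⟨v, hv, rfl⟩⟩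

/-- The complex of `k`-equal trees is isomorphic to the reduced minimal nested set complex of the
`k`-equal lattice. -/
noncomputable def nestedSetIso (hk : 2 ≤ k) (hkn : k < n) :
    ComplexIso (kEqualTreeComplex n k)
      (reducedNestedSetComplex (irreducibles (KEqualLattice n k))) where
  toEquiv := vertexEquiv hk hkn
  mem_faces_iff s := by
    rw [mem_faces_iff hk hkn, jointFam_map hk hkn]
    constructor
    · rintro ⟨hne, -, h⟩
      refine ⟨?_, (isNested_irreducibles_iff hk).2 ⟨?_, ?_⟩, ?_⟩
      · simpa using hne
      · intro X hX
        obtain ⟨v, -, rfl⟩ := (mem_map_vertexEquiv hk hkn).1 (Finset.mem_coe.1 hX)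
        exact block_mem_irreducibles hk _
      · rw [blocks_map]
        exact h.1
      · intro ht
        obtain ⟨v, -, e⟩ := (mem_map_vertexEquiv hk hkn).1 ht
        exact (block_ne_top hk hkn.le _).2 (ncard_vertexBlock hk hkn v).2 e.symm
    · rintro ⟨hne, h, -⟩
      refine ⟨?_, ?_, ?_, ?_⟩
      · simpa using hne
      · intro ν hν
        obtain ⟨v, -, rfl⟩ := Finset.mem_map.1 hν
        exact hasOneInternalEdge_iff.2 ⟨_, fam_eq_vertexBlock hk hkn v⟩
      · have := ((isNested_irreducibles_iff hk).1 h).2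
        rwa [blocks_map] at this
      · rintro B ⟨v, -, rfl⟩
        exact ncard_vertexBlock hk hkn v

theorem nestedSetIso_image (hk : 2 ≤ k) (hkn : k < n) (T : LabelledTree n)
    (hT : T.type ∈ kEqualTreeTypes n k) :
    (fun v => ((nestedSetIso hk hkn).toEquiv v).1.1) '' {v | v.1 ∈ T.type.vertexSet} =
      T.nestedSet := by
  have hK := (mem_kEqualTreeTypes hk hkn).1 hT
  ext π
  constructor
  · rintro ⟨v, hv, rfl⟩
    obtain ⟨B, ⟨t, ht, rfl⟩, e⟩ := mem_vertexSet.1 hv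
    refine ⟨t, ht, ?_⟩
    rw [← Set.singleton_injective ((fam_eq_vertexBlock hk hkn v).symm.trans e)]
    rfl
  · rintro ⟨t, ht, rfl⟩
    have hB : T.leavesBelow t ∈ T.type.fam := ⟨t, ht, rfl⟩
    obtain ⟨ν, hν⟩ := exists_fam_eq_singleton (by omega) T.type hB
    let v : vertices (kEqualTreeComplex n k) :=
      ⟨ν, (mem_vertices_iff hk hkn).2 ⟨_, hν, hK.2 _ hB⟩⟩
    refine ⟨v, mem_vertexSet.2 ⟨_, hB, hν⟩, ?_⟩
    rw [← Set.singleton_injective ((fam_eq_vertexBlock hk hkn v).symm.trans hν)]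
    rfl

/-- The identity isomorphism. -/
def ComplexIso.refl {V : Type*} (K : PreAbstractSimplicialComplex V) : ComplexIso K K where
  toEquiv := Equiv.refl _
  mem_faces_iff s := by
    rw [Equiv.refl_toEmbedding, Finset.map_refl]

end TreeComplex

/-! ### The proposition -/

open TreeComplex
theorem mainTheorem7 (n k : ℕ) (hk : 2 ≤ k) (hkn : k < n) :
    -- the simplices of `T_{n,k}` are given by the combinatorial types of `k`-equal trees
    -- with at least one internal edge, ordered by contraction of internal edges,
    -- and the maximal simplices by the types that are binary except at `k`-ary preleaves
    ((∀ s : Finset (TreeType n), s ∈ (kEqualTreeComplex n k).faces ↔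
        s.Nonempty ∧ ∃ τ ∈ kEqualTreeTypes n k, (s : Set (TreeType n)) = τ.vertexSet) ∧
      Set.InjOn TreeType.vertexSet (kEqualTreeTypes n k) ∧
      (∀ σ ∈ kEqualTreeTypes n k, ∀ τ ∈ kEqualTreeTypes n k,
        σ.vertexSet ⊆ τ.vertexSet ↔ τ.IsContraction σ) ∧
      (∀ s : Finset (TreeType n), Maximal (· ∈ (kEqualTreeComplex n k).faces) s ↔
        ∃ μ ∈ maximalTreeTypes n k, (s : Set (TreeType n)) = μ.vertexSet)) ∧
    -- `T_{n,k}` and the reduced minimal nested set complex coincide, where a tree is identified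
    -- with the nested set given by the leaf sets below its internal vertices
    (∃ e : ComplexIso (kEqualTreeComplex n k)
        (reducedNestedSetComplex (irreducibles (KEqualLattice n k))),
      ∀ T : LabelledTree n, T.type ∈ kEqualTreeTypes n k →
        (fun v => (e.toEquiv v).1.1) '' {v | v.1 ∈ T.type.vertexSet} = T.nestedSet) ∧
    -- the order complex is obtained from `T_{n,k}` by stellar subdivisions
    ObtainedByStellarSubdivisions (kEqualTreeComplex n k) (orderComplex (KEqualLattice n k)) := by
  have hn : 2 ≤ n := by omega
  refine ⟨⟨fun s => ⟨fun h => ?_, ?_⟩, ?_, ?_, maximal_face_iff hk hkn⟩,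
    ⟨nestedSetIso hk hkn, nestedSetIso_image hk hkn⟩,
    -- The lattice itself serves as the ambient vertex type: the new vertices are its reducible
    -- elements, so the second isomorphism is the identity.
    ⟨KEqualLattice n k, _, _, ⟨nestedSetIso hk hkn⟩, KEqualLattice.stellar hk hkn.le,
      ⟨ComplexIso.refl _⟩⟩⟩
  · obtain ⟨hne, h1, h2⟩ := (mem_faces_iff hk hkn).1 h
    obtain ⟨τ, hτ⟩ := TreeType.exists_fam_eq hn (h2.isTreeFamily hk)
    exact ⟨hne, τ, (TreeType.mem_kEqualTreeTypes hk hkn).2 (hτ ▸ h2),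
      TreeType.eq_vertexSet h1 hτ⟩
  · rintro ⟨hne, τ, ⟨μ, hμ, hτ⟩, hs⟩
    refine ⟨hne, μ, hμ, hs.le.trans ?_⟩
    exact (TreeType.vertexSet_subset_iff hn).2 (TreeType.isContraction_iff.1 hτ)
  · intro σ _ τ _ h
    exact TreeType.fam_injective (Set.Subset.antisymm
      ((TreeType.vertexSet_subset_iff hn).1 h.le) ((TreeType.vertexSet_subset_iff hn).1 h.ge))
  · intro σ _ τ _
    rw [TreeType.vertexSet_subset_iff hn, TreeType.isContraction_iff]
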